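/- Let $n\ge 0$ be an integer, $T>0$, $\Omega=\mathbb R^n/\mathbb Z^n$ the flat torus, $I=[0,T]$, $\Omega_I=\Omega\times I$. An orbit is a measure $\mu=\mu_{(t)}\,dt$ on $\Omega_I$, with $t\mapsto\mu_{(t)}$ a measurable family of Borel probability measures on $\Omega$. Let $C^1_0(\Omega_I)$ be the set of functions $\phi(x,t)$ of class $C^1$ on $\Omega_I$ with $\phi(\cdot,0)=\phi(\cdot,T)=0$. A lifting of an orbit $\mu$ is a Borel measure $\nu$ on $\Omega_I\times\mathbb R^n$ with marginal $\mu$ on $\Omega_I$ such that, for every $\psi\in C^1_0(\Omega_I)$, the function $\psi_t+v\cdot\nabla_x\psi$ is $\nu$-integrable and $\int(\psi_t+v\cdot\nabla_x\psi)\,\nu(dx\,dt\,dv)=0$. Let ${\bf H}_2$ be the set of orbits $\mu$ having a lifting $\nu$ with $\int|v|^2\,d\nu<\infty$, and for such $\mu$ let $\|\mu\|_2=\inf_\nu\left(\int|v|^2\,d\nu\right)^{1/2}$, the infimum being over all liftings $\nu$ of $\mu$. For Borel probability measures $\mu_0,\mu_1$ on $\Omega$, let $\Lambda_2(\mu_0,\mu_1)$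 be the set of $\mu\in{\bf H}_2$ that can be written $\mu=\mu_{(t)}\,dt$ with $t\mapsto\mu_{(t)}$ weakly continuous on $[0,T]$, $\mu_{(0)}=\mu_0$ and $\mu_{(T)}=\mu_1$. Then for every $\mu\in{\bf H}_2$ $$\frac12\|\mu\|_2^2=-\inf_{\phi\in C^1_0(\Omega_I)}\int_{\Omega_I}\Big(\phi_t+\frac{|\nabla_x\phi|^2}{2}\Big)\,d\mu=\frac12\sup_{\phi\in C^1_0(\Omega_I)}\frac{\left(\int_{\Omega_I}\phi_t\,d\mu\right)^2}{\int_{\Omega_I}|\nabla_x\phi|^2\,d\mu},$$ where the quotient is taken in $[0,\infty]$ with $0/0=0$ and $a/0=\infty$ for $a>0$. Moreover, for every $\mu\in{\bf H}_2$ and all Borel probability measures $\mu_0,\mu_1$ on $\Omega$, $$-\inf_{\phi}\left\{\int_{\Omega_I}\Big(\phi_t+\frac{|\nabla_x\phi|^2}{2}\Big)\,d\mu+\int_\Omega\phi(x,0)\,\mu_0(dx)-\int_\Omega\phi(x,T)\,\mu_1(dx)\right\}=\begin{cases}\frac12\|\mu\|_2^2&\text{if }\mu\in\Lambda_2(\mu_0,\mu_1),\\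 +\infty&\text{if }\mu\notin\Lambda_2(\mu_0,\mu_1),\end{cases}$$ where the infimum is over all $\phi$ that are Lipschitz on $\Omega\times[0,T]$ and of class $C^1$ on $\Omega\times(0,T)$. -/

import Mathlib

open MeasureTheory ProbabilityTheory Set
open scoped ENNReal

noncomputable section

namespace MeasureOrbit

/-- The Euclidean space `ℝⁿ` (velocities, and the universal cover of the torus). -/
abbrev Vel (n : ℕ) : Type := EuclideanSpace ℝ (Fin n)

/-- The flat torus `Ω = ℝⁿ / ℤⁿ`. -/
abbrev Torus (n : ℕ) : Type := UnitAddTorus (Fin n)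

/-- The covering map `ℝⁿ → ℝⁿ / ℤⁿ`. -/
def proj {n : ℕ} (y : Vel n) : Torus n := fun i => (y i : UnitAddCircle)

/-- The periodic lift to `ℝ × ℝⁿ` of a function `φ(t, x)` of time and of a point of the torus. -/
def lift {n : ℕ} (φ : ℝ → Torus n → ℝ) : ℝ × Vel n → ℝ := fun q => φ q.1 (proj q.2)

/-- The time derivative `φ_t (t, x)`. For the functions below it is the classical derivative when
`0 < t < T`; the slices `t = 0` and `t = T` are null sets of all measures it is integrated against. -/
def timeDeriv {n : ℕ} (φ : ℝ → Torus n → ℝ) (t : ℝ) (x : Torus n) : ℝ :=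
  deriv (fun s => φ s x) t

/-- The spatial gradient `∇ₓ φ (t, x)`, computed in the flat chart `y ↦ x + proj y` around `x`. -/
def spaceGrad {n : ℕ} (φ : ℝ → Torus n → ℝ) (t : ℝ) (x : Torus n) : Vel n :=
  gradient (fun y : Vel n => φ t (x + proj y)) 0

/-- `C¹₀(Ω × [0,T])`: functions of class `C¹` on `Ω × [0,T]` (up to the end times) which vanish at
`t = 0` and at `t = T`. -/
def C10 (n : ℕ) (T : ℝ) : Set (ℝ → Torus n → ℝ) :=
  {φ | ContDiffOn ℝ 1 (lift φ) (Icc 0 T ×ˢ univ) ∧ (∀ x, φ 0 x = 0) ∧ ∀ x, φ T x = 0}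

/-- `C¹(Ω × (0,T)) ∩ LIP(Ω × [0,T])`. -/
def C1Lip (n : ℕ) (T : ℝ) : Set (ℝ → Torus n → ℝ) :=
  {φ | ContDiffOn ℝ 1 (lift φ) (Ioo 0 T ×ˢ univ) ∧
    ∃ K : NNReal, LipschitzOnWith K (lift φ) (Icc 0 T ×ˢ univ)}

/-- `μ = μ_(t) dt` on `[0,T] × Ω`, where `μ_(t) = κ t` is a probability measure for each `t`. -/
def Decomposes {n : ℕ} (T : ℝ) (μ : Measure (ℝ × Torus n)) (κ : Kernel ℝ (Torus n)) : Prop :=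
  IsMarkovKernel κ ∧ μ = (volume.restrict (Icc 0 T)).compProd κ

/-- The orbits: measures on `[0,T] × Ω` of the form `μ_(t) dt`, `μ_(t)` probability measures. -/
def Orbits (n : ℕ) (T : ℝ) : Set (Measure (ℝ × Torus n)) :=
  {μ | ∃ κ : Kernel ℝ (Torus n), Decomposes T μ κ}

/-- `ν(dt dx dv)` is a lifting of `μ(dt dx)`: its marginal is `μ`, and it solves the weak
continuity equation `∫ (ψ_t + v · ∇ₓ ψ) dν = 0` for all `ψ ∈ C¹₀(Ω × [0,T])`. -/
def IsLifting {n : ℕ} (T : ℝ) (μ : Measure (ℝ × Torus n))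
    (ν : Measure ((ℝ × Torus n) × Vel n)) : Prop :=
  ν.map Prod.fst = μ ∧
  ∀ ψ ∈ C10 n T,
    Integrable (fun q : (ℝ × Torus n) × Vel n =>
      timeDeriv ψ q.1.1 q.1.2 + inner ℝ q.2 (spaceGrad ψ q.1.1 q.1.2)) ν ∧
    ∫ q, (timeDeriv ψ q.1.1 q.1.2 + inner ℝ q.2 (spaceGrad ψ q.1.1 q.1.2)) ∂ν = 0

/-- The set `H_p` of the orbits that have a lifting with finite `p`-th velocity moment. -/
def H (n : ℕ) (T p : ℝ) : Set (Measure (ℝ × Torus n)) :=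
  {μ | μ ∈ Orbits n T ∧ ∃ ν, IsLifting T μ ν ∧ ∫⁻ q, ‖q.2‖ₑ ^ p ∂ν < ∞}

/-- `‖μ‖_p`, the infimum over all liftings `ν` of `(∫ |v|^p dν)^(1/p)`. -/
def hNorm {n : ℕ} (T p : ℝ) (μ : Measure (ℝ × Torus n)) : ℝ≥0∞ :=
  ⨅ (ν : Measure ((ℝ × Torus n) × Vel n)) (_ : IsLifting T μ ν), (∫⁻ q, ‖q.2‖ₑ ^ p ∂ν) ^ (1 / p)

/-- `Λ_p(μ₀, μ₁)`: the `μ = μ_(t) dt` in `H_p` with `μ_(0) = μ₀` and `μ_(T) = μ₁`, where `μ_(t)` is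
the weakly continuous version of the decomposition. -/
def Lam {n : ℕ} (T p : ℝ) (μ₀ μ₁ : Measure (Torus n)) : Set (Measure (ℝ × Torus n)) :=
  {μ | μ ∈ H n T p ∧ ∃ κ : Kernel ℝ (Torus n), Decomposes T μ κ ∧
    (∀ f : C(Torus n, ℝ), ContinuousOn (fun t => ∫ x, f x ∂(κ t)) (Icc 0 T)) ∧
    κ 0 = μ₀ ∧ κ T = μ₁}

/-- `∫ (φ_t + |∇ₓ φ|² / 2) dμ`. -/
def hjIntegral {n : ℕ} (μ : Measure (ℝ × Torus n)) (φ : ℝ → Torus n → ℝ) : ℝ :=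
  ∫ q, (timeDeriv φ q.1 q.2 + ‖spaceGrad φ q.1 q.2‖ ^ 2 / 2) ∂μ

/-- `(∫ φ_t dμ)² / ∫ |∇ₓ φ|² dμ` in `[0,∞]`, with `0 / 0 = 0` and `a / 0 = ∞` for `a > 0`. -/
def quotient {n : ℕ} (μ : Measure (ℝ × Torus n)) (φ : ℝ → Torus n → ℝ) : ℝ≥0∞ :=
  ENNReal.ofReal ((∫ q, timeDeriv φ q.1 q.2 ∂μ) ^ 2) /
    ENNReal.ofReal (∫ q, ‖spaceGrad φ q.1 q.2‖ ^ 2 ∂μ)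

/-- `∫ (φ_t + |∇ₓ φ|² / 2) dμ + ∫ φ(·,0) dμ₀ - ∫ φ(·,T) dμ₁`. -/
def hjBoundary {n : ℕ} (T : ℝ) (μ : Measure (ℝ × Torus n)) (μ₀ μ₁ : Measure (Torus n))
    (φ : ℝ → Torus n → ℝ) : ℝ :=
  hjIntegral μ φ + ∫ x, φ 0 x ∂μ₀ - ∫ x, φ T x ∂μ₁

end MeasureOrbit

end

/-!
For a lifting `ν` of `μ` and `φ ∈ C¹₀`, the transport equation `∫ (φ_t + v · ∇ₓ φ) dν = 0` turns
`-∫ (φ_t + |∇ₓ φ|² / 2) dμ` into `∫ (v · ∇ₓ φ - |∇ₓ φ|² / 2) dν`, which is at most `½ ∫ |v|² dν` by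
Young's inequality. Conversely, if the quotients `(∫ φ_t dμ)² / ∫ |∇ₓ φ|² dμ` are bounded by `C`,
then `φ ↦ -∫ φ_t dμ` is a functional of norm at most `√C` on the gradients in `L²(μ)`. By Riesz it
is represented by a vector field `w` with `∫ |w|² dμ ≤ C`, and the graph measure `δ_{w(t,x)}(dv) μ`
is a lifting. Replacing `φ` by `c φ` and optimizing over `c` links the quotients with the infimum.

For test functions that do not vanish at the end times, the transport equation produces the values
at `0` and `T` of the weakly continuous version of `μ`. If one of them differs from the
prescribed measure, the test functions `c (t / T)^N f(x)` or `c (1 - t / T)^N f(x)` detect it as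
`N → ∞`: their gradients vanish in the limit, whereas the boundary mismatch persists and is
proportional to `c`.
-/

namespace MeasureOrbit

open Filter Topology

variable {n : ℕ}

section Torus

lemma proj_add (y z : Vel n) : proj (y + z) = proj y + proj z := by
  ext i; simp [proj]

lemma isOpenQuotientMap_proj : IsOpenQuotientMap (proj : Vel n → Torus n) :=
  (IsOpenQuotientMap.piMap fun _ => QuotientAddGroup.isOpenQuotientMap_mk).comp
    (EuclideanSpace.equiv (Fin n) ℝ).toHomeomorph.isOpenQuotientMap

lemma exists_isCompact_image_proj_eq_univ :
    ∃ K : Set (Vel n), IsCompact K ∧ proj '' K = univ := by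
  refine ⟨EuclideanSpace.equiv (Fin n) ℝ ⁻¹' univ.pi fun _ => Icc 0 1,
    (EuclideanSpace.equiv (Fin n) ℝ).toHomeomorph.isCompact_preimage.2
      (isCompact_univ_pi fun _ => isCompact_Icc), eq_univ_of_forall fun x => ?_⟩
  have hx : ∀ i, ∃ r ∈ Icc (0 : ℝ) 1, (r : UnitAddCircle) = x i := fun i => by
    have h := AddCircle.coe_image_Icc_eq (1 : ℝ) 0
    rw [zero_add] at h
    exact h.ge (mem_univ (x i))
  choose r hr hrx using hx
  exact ⟨WithLp.toLp 2 r, fun i _ => hr i, funext hrx⟩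

lemma continuousOn_prod_univ_of_comp_proj {X E : Type*} [TopologicalSpace X] [TopologicalSpace E]
    {g : X × Torus n → E} {s : Set X}
    (hg : ContinuousOn (g ∘ Prod.map id proj) (s ×ˢ univ)) : ContinuousOn g (s ×ˢ univ) := by
  have hq := (IsOpenQuotientMap.id (X := X)).prodMap (isOpenQuotientMap_proj (n := n))
  rw [continuousOn_iff_continuous_domRestrict,
    ← (hq.restrictPreimage (s ×ˢ univ)).continuous_comp_iff]
  exact continuousOn_iff_continuous_domRestrict.1 hg

end Torus

section Calculus

variable {φ ψ : ℝ → Torus n → ℝ} {U : Set ℝ} {t : ℝ}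

lemma hasDerivAt_fderiv_lift {y : Vel n} (h : DifferentiableAt ℝ (lift φ) (t, y)) :
    HasDerivAt (fun s => φ s (proj y)) (fderiv ℝ (lift φ) (t, y) (1, 0)) t :=
  HasFDerivAt.comp_hasDerivAt (l := lift φ) t h.hasFDerivAt
    ((hasDerivAt_id t).prodMk (hasDerivAt_const t y))

lemma hasFDerivAt_fderiv_lift {y : Vel n} (h : DifferentiableAt ℝ (lift φ) (t, y)) :
    HasFDerivAt (fun z : Vel n => φ t (proj y + proj z))
      ((fderiv ℝ (lift φ) (t, y)).comp (ContinuousLinearMap.inr ℝ ℝ (Vel n))) 0 := by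
  have hshift : HasFDerivAt (fun z : Vel n => (t, y + z)) (ContinuousLinearMap.inr ℝ ℝ (Vel n)) 0 :=
    (hasFDerivAt_const t 0).prodMk ((hasFDerivAt_id 0).const_add y)
  have hlift : HasFDerivAt (lift φ) (fderiv ℝ (lift φ) (t, y)) (t, y + 0) := by
    simpa only [add_zero] using h.hasFDerivAt
  simpa only [Function.comp_def, lift, proj_add] using hlift.comp 0 hshift

lemma timeDeriv_proj {y : Vel n} (h : DifferentiableAt ℝ (lift φ) (t, y)) :
    timeDeriv φ t (proj y) = fderiv ℝ (lift φ) (t, y) (1, 0) :=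
  (hasDerivAt_fderiv_lift h).deriv

lemma spaceGrad_proj {y : Vel n} (h : DifferentiableAt ℝ (lift φ) (t, y)) :
    spaceGrad φ t (proj y) = (InnerProductSpace.toDual ℝ (Vel n)).symm
      ((fderiv ℝ (lift φ) (t, y)).comp (ContinuousLinearMap.inr ℝ ℝ (Vel n))) :=
  (hasFDerivAt_fderiv_lift h).hasGradientAt.gradient

lemma differentiableAt_lift (h : ContDiffOn ℝ 1 (lift φ) (U ×ˢ univ)) (hU : U ∈ 𝓝 t)
    (y : Vel n) : DifferentiableAt ℝ (lift φ) (t, y) :=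
  (h.differentiableOn one_ne_zero).differentiableAt (prod_mem_nhds hU univ_mem)

lemma differentiableAt_time (h : ContDiffOn ℝ 1 (lift φ) (U ×ˢ univ)) (hU : U ∈ 𝓝 t)
    (x : Torus n) : DifferentiableAt ℝ (fun s => φ s x) t := by
  obtain ⟨y, rfl⟩ := isOpenQuotientMap_proj.surjective x
  exact (hasDerivAt_fderiv_lift (differentiableAt_lift h hU y)).differentiableAt

lemma differentiableAt_space (h : ContDiffOn ℝ 1 (lift φ) (U ×ˢ univ)) (hU : U ∈ 𝓝 t)
    (x : Torus n) : DifferentiableAt ℝ (fun y => φ t (x + proj y)) 0 := by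
  obtain ⟨y, rfl⟩ := isOpenQuotientMap_proj.surjective x
  exact (hasFDerivAt_fderiv_lift (differentiableAt_lift h hU y)).differentiableAt

lemma continuousOn_timeDeriv (h : ContDiffOn ℝ 1 (lift φ) (U ×ˢ univ)) (hU : IsOpen U) :
    ContinuousOn (fun q : ℝ × Torus n => timeDeriv φ q.1 q.2) (U ×ˢ univ) := by
  refine continuousOn_prod_univ_of_comp_proj ?_
  have hfderiv := h.continuousOn_fderiv_of_isOpen (hU.prod isOpen_univ) le_rfl
  refine (hfderiv.clm_apply (continuousOn_const (c := ((1 : ℝ), (0 : Vel n))))).congr ?_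
  rintro ⟨t, y⟩ ⟨ht, -⟩
  exact timeDeriv_proj (differentiableAt_lift h (hU.mem_nhds ht) y)

lemma continuousOn_spaceGrad (h : ContDiffOn ℝ 1 (lift φ) (U ×ˢ univ)) (hU : IsOpen U) :
    ContinuousOn (fun q : ℝ × Torus n => spaceGrad φ q.1 q.2) (U ×ˢ univ) := by
  refine continuousOn_prod_univ_of_comp_proj ?_
  have hfderiv := h.continuousOn_fderiv_of_isOpen (hU.prod isOpen_univ) le_rfl
  refine ((InnerProductSpace.toDual ℝ (Vel n)).symm.continuous.comp_continuousOn
    (hfderiv.clm_comp (continuousOn_const (c := ContinuousLinearMap.inr ℝ ℝ (Vel n))))).congr ?_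
  rintro ⟨t, y⟩ ⟨ht, -⟩
  exact spaceGrad_proj (differentiableAt_lift h (hU.mem_nhds ht) y)

lemma timeDeriv_add {x : Torus n} (hφ : DifferentiableAt ℝ (fun s => φ s x) t)
    (hψ : DifferentiableAt ℝ (fun s => ψ s x) t) :
    timeDeriv (φ + ψ) t x = timeDeriv φ t x + timeDeriv ψ t x :=
  deriv_add hφ hψ

lemma timeDeriv_smul (c : ℝ) (x : Torus n) : timeDeriv (c • φ) t x = c * timeDeriv φ t x :=
  deriv_const_mul_field c

lemma timeDeriv_mul {η : ℝ → ℝ} {x : Torus n} (hη : DifferentiableAt ℝ η t)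
    (hφ : DifferentiableAt ℝ (fun s => φ s x) t) :
    timeDeriv (fun s x => η s * φ s x) t x = deriv η t * φ t x + η t * timeDeriv φ t x :=
  deriv_mul hη hφ

lemma spaceGrad_add {x : Torus n} (hφ : DifferentiableAt ℝ (fun y => φ t (x + proj y)) 0)
    (hψ : DifferentiableAt ℝ (fun y => ψ t (x + proj y)) 0) :
    spaceGrad (φ + ψ) t x = spaceGrad φ t x + spaceGrad ψ t x := by
  simp only [spaceGrad, gradient, ← map_add]
  exact congrArg _ (fderiv_add hφ hψ)

lemma spaceGrad_mul (η : ℝ → ℝ) (x : Torus n) :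
    spaceGrad (fun s x => η s * φ s x) t x = η t • spaceGrad φ t x := by
  simp only [spaceGrad, gradient, ← map_smul]
  exact congrArg _ (congrFun (fderiv_const_smul_field (η t)) 0)

lemma spaceGrad_smul (c : ℝ) (x : Torus n) : spaceGrad (c • φ) t x = c • spaceGrad φ t x :=
  spaceGrad_mul (fun _ => c) x

end Calculus

section Lipschitz

variable {φ : ℝ → Torus n → ℝ} {S : Set ℝ} {K : NNReal} {t : ℝ}

lemma lipschitzOnWith_time (h : LipschitzOnWith K (lift φ) (S ×ˢ univ)) (x : Torus n) :
    LipschitzOnWith K (fun s => φ s x) S := by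
  obtain ⟨y, rfl⟩ := isOpenQuotientMap_proj.surjective x
  have hline : LipschitzOnWith 1 (fun s => (s, y)) S :=
    (LipschitzWith.prodMk_right y).lipschitzOnWith
  simpa only [mul_one, Function.comp_def, lift] using
    h.comp hline fun s hs => ⟨hs, mem_univ y⟩

lemma lipschitzWith_space (h : LipschitzOnWith K (lift φ) (S ×ˢ univ)) (ht : t ∈ S)
    (x : Torus n) : LipschitzWith K fun y => φ t (x + proj y) := by
  obtain ⟨z, rfl⟩ := isOpenQuotientMap_proj.surjective x
  have hshift : LipschitzWith 1 fun y : Vel n => (t, z + y) := by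
    simpa only [mul_one, Function.comp_def] using
      (LipschitzWith.prodMk_left t).comp (isometry_add_left z).lipschitz
  have hcomp := h.comp (hshift.lipschitzOnWith (s := univ)) fun y _ => ⟨ht, mem_univ (z + y)⟩
  simpa only [mul_one, lipschitzOnWith_univ, Function.comp_def, lift, proj_add] using hcomp

lemma continuousOn_uncurry (h : LipschitzOnWith K (lift φ) (S ×ˢ univ)) :
    ContinuousOn (Function.uncurry φ) (S ×ˢ univ) :=
  continuousOn_prod_univ_of_comp_proj h.continuousOn

lemma continuous_space (h : LipschitzOnWith K (lift φ) (S ×ˢ univ)) (ht : t ∈ S) :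
    Continuous (φ t) :=
  (continuousOn_uncurry h).comp_continuous (Continuous.prodMk_right t) fun x => ⟨ht, mem_univ x⟩

lemma abs_timeDeriv_le (h : LipschitzOnWith K (lift φ) (S ×ˢ univ)) (hS : S ∈ 𝓝 t)
    (x : Torus n) : |timeDeriv φ t x| ≤ K :=
  norm_deriv_le_of_lipschitzOn hS (lipschitzOnWith_time h x)

lemma norm_spaceGrad_le (h : LipschitzOnWith K (lift φ) (S ×ˢ univ)) (ht : t ∈ S)
    (x : Torus n) : ‖spaceGrad φ t x‖ ≤ K := by
  rw [spaceGrad, gradient, LinearIsometryEquiv.norm_map]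
  exact norm_fderiv_le_of_lipschitz ℝ (lipschitzWith_space h ht x)

open scoped Pointwise in
lemma fderivWithin_lift_eq_of_proj_eq {y z : Vel n} (h : proj z = proj y) :
    fderivWithin ℝ (lift φ) (S ×ˢ univ) (t, z) = fderivWithin ℝ (lift φ) (S ×ˢ univ) (t, y) := by
  have hperiod : proj (z - y) = 0 := by
    rw [← add_eq_right, ← proj_add, sub_add_cancel, h]
  have hlift : (fun q => lift φ (q + (0, z - y))) = lift φ := by
    ext q
    simp only [lift, Prod.fst_add, Prod.snd_add, proj_add, hperiod, add_zero]
  have hset : ((0, z - y) : ℝ × Vel n) +ᵥ S ×ˢ (univ : Set (Vel n)) = S ×ˢ univ := by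
    ext q
    simp [mem_vadd_set_iff_neg_vadd_mem]
  have hshift := fderivWithin_comp_add_right (𝕜 := ℝ) (f := lift φ) (s := S ×ˢ univ) (x := (t, y))
    (0, z - y)
  rw [hlift, hset, Prod.mk_add_mk, add_zero, add_sub_cancel] at hshift
  exact hshift.symm

lemma exists_lipschitzOnWith_lift (hS : IsCompact S) (hconv : Convex ℝ S) (hud : UniqueDiffOn ℝ S)
    (h : ContDiffOn ℝ 1 (lift φ) (S ×ˢ univ)) :
    ∃ K : NNReal, LipschitzOnWith K (lift φ) (S ×ˢ univ) := by
  obtain ⟨D, hD, hDuniv⟩ := exists_isCompact_image_proj_eq_univ (n := n)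
  have hcont := h.continuousOn_fderivWithin (hud.prod uniqueDiffOn_univ) le_rfl
  obtain ⟨C, hC⟩ := (hS.prod hD).exists_bound_of_continuousOn
    (hcont.mono (prod_mono le_rfl (subset_univ D)))
  refine ⟨C.toNNReal, (hconv.prod convex_univ).lipschitzOnWith_of_nnnorm_fderivWithin_le
    (𝕜 := ℝ) (h.differentiableOn one_ne_zero) ?_⟩
  rintro ⟨t, y⟩ ⟨ht, -⟩
  obtain ⟨z, hz, hzy⟩ := hDuniv.ge (mem_univ (proj y))
  rw [← fderivWithin_lift_eq_of_proj_eq hzy, ← norm_toNNReal]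
  exact Real.toNNReal_le_toNNReal (hC (t, z) ⟨ht, hz⟩)

end Lipschitz

section TestFunctions

variable {T : ℝ} {φ : ℝ → Torus n → ℝ}

lemma C10_subset_C1Lip (hT : 0 < T) : C10 n T ⊆ C1Lip n T := fun _ h =>
  ⟨h.1.mono (prod_mono Ioo_subset_Icc_self le_rfl),
    exists_lipschitzOnWith_lift isCompact_Icc (convex_Icc 0 T) (uniqueDiffOn_Icc hT) h.1⟩

/-- The space `C¹₀(Ω × [0,T])` of test functions as a vector space, the domain of the linear maps
to which duality is applied. -/
def c10Submodule (n : ℕ) (T : ℝ) : Submodule ℝ (ℝ → Torus n → ℝ) where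
  carrier := C10 n T
  add_mem' {φ ψ} hφ hψ := ⟨hφ.1.add hψ.1, fun x => by simp [hφ.2.1, hψ.2.1],
    fun x => by simp [hφ.2.2, hψ.2.2]⟩
  zero_mem' := ⟨contDiffOn_const (c := (0 : ℝ)), fun _ => rfl, fun _ => rfl⟩
  smul_mem' c φ hφ := ⟨contDiffOn_const.mul hφ.1, fun x => by simp [hφ.2.1],
    fun x => by simp [hφ.2.2]⟩

lemma mul_mem_C10 {η : ℝ → ℝ} (hη : ContDiff ℝ 1 η) (hsupp : tsupport η ⊆ Ioo 0 T)
    (hφ : ContDiffOn ℝ 1 (lift φ) (Ioo 0 T ×ˢ univ)) : (fun t x => η t * φ t x) ∈ C10 n T := by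
  have hzero : ∀ t ∉ Ioo 0 T, η t = 0 := fun t ht =>
    image_eq_zero_of_notMem_tsupport fun h => ht (hsupp h)
  refine ⟨?_, fun x => by simp [hzero], fun x => by simp [hzero]⟩
  rintro ⟨t, y⟩ -
  refine ContDiffAt.contDiffWithinAt ?_
  by_cases ht : t ∈ Ioo 0 T
  · exact (hη.contDiffAt.comp (t, y) contDiffAt_fst).mul
      (hφ.contDiffAt ((isOpen_Ioo.prod isOpen_univ).mem_nhds ⟨ht, mem_univ y⟩))
  · have hnear : ∀ᶠ s in 𝓝 t, η s = 0 := notMem_tsupport_iff_eventuallyEq.1 fun h => ht (hsupp h)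
    refine (contDiffAt_const (c := (0 : ℝ))).congr_of_eventuallyEq ?_
    filter_upwards [continuousAt_fst.eventually hnear] with q hq
    simp only [lift, hq, zero_mul]

end TestFunctions

section Measures

/-- The total kinetic energy `∫ |v|² dν` of a measure on a space of positions and velocities; its
infimum over the liftings of `μ` is `‖μ‖₂²`. -/
noncomputable def kineticEnergy {X : Type*} [MeasurableSpace X] (ν : Measure (X × Vel n)) : ℝ≥0∞ :=
  ∫⁻ q, ‖q.2‖ₑ ^ (2 : ℝ) ∂ν

/-- The material derivative `φ_t + v · ∇ₓ φ` at the point `((t, x), v)`. -/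
noncomputable def materialDeriv (φ : ℝ → Torus n → ℝ) (q : (ℝ × Torus n) × Vel n) : ℝ :=
  timeDeriv φ q.1.1 q.1.2 + inner ℝ q.2 (spaceGrad φ q.1.1 q.1.2)

/-- `∫ (|∇ₓ φ|² / 2 - v · ∇ₓ φ) dν`, which becomes `½ ∫ |v - ∇ₓ φ|² dν` when half the kinetic
energy is added to it, and which is the difference of the Hamilton–Jacobi integral and of the
integral of the material derivative. -/
noncomputable def youngDefect (ν : Measure ((ℝ × Torus n) × Vel n)) (φ : ℝ → Torus n → ℝ) : ℝ :=
  ∫ q, (‖spaceGrad φ q.1.1 q.1.2‖ ^ 2 / 2 - inner ℝ q.2 (spaceGrad φ q.1.1 q.1.2)) ∂ν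

section Energy

variable {X : Type*} [MeasurableSpace X] {ν : Measure (X × Vel n)}

lemma kineticEnergy_eq_eLpNorm_sq (ν : Measure (X × Vel n)) :
    kineticEnergy ν = eLpNorm Prod.snd 2 ν ^ 2 := by
  simpa [kineticEnergy] using (eLpNorm_nnreal_pow_eq_lintegral (μ := ν)
    (f := (Prod.snd : X × Vel n → Vel n)) (p := 2) two_ne_zero).symm

lemma memLp_velocity (hν : kineticEnergy ν ≠ ∞) : MemLp Prod.snd 2 ν := by
  refine ⟨measurable_snd.aestronglyMeasurable, lt_top_iff_ne_top.2 fun h => hν ?_⟩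
  rw [kineticEnergy_eq_eLpNorm_sq, h, ENNReal.top_pow two_ne_zero]

lemma integral_norm_sq_velocity (ν : Measure (X × Vel n)) :
    ∫ q, ‖q.2‖ ^ 2 ∂ν = (kineticEnergy ν).toReal := by
  rw [integral_eq_lintegral_of_nonneg_ae (Eventually.of_forall fun q => by positivity)
    (measurable_snd.norm.pow_const 2).aestronglyMeasurable]
  simp only [kineticEnergy, ENNReal.ofReal_pow (norm_nonneg _), ofReal_norm, ENNReal.rpow_ofNat]

end Energy

variable {T : ℝ} {φ : ℝ → Torus n → ℝ} {μ : Measure (ℝ × Torus n)}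
  {ν : Measure ((ℝ × Torus n) × Vel n)}

lemma isFiniteMeasure_of_mem_Orbits (h : μ ∈ Orbits n T) : IsFiniteMeasure μ := by
  obtain ⟨κ, hκ, rfl⟩ := h
  infer_instance

lemma measurePreserving_time_of_mem_Orbits (h : μ ∈ Orbits n T) :
    MeasurePreserving Prod.fst μ (volume.restrict (Icc 0 T)) := by
  obtain ⟨κ, hκ, rfl⟩ := h
  exact ⟨measurable_fst, Measure.fst_compProd _ κ⟩

lemma ae_mem_Ioo_of_mem_Orbits (h : μ ∈ Orbits n T) : ∀ᵐ q ∂μ, q.1 ∈ Ioo 0 T := by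
  refine (measurePreserving_time_of_mem_Orbits h).quasiMeasurePreserving.ae ?_
  rw [← restrict_Ioo_eq_restrict_Icc]
  exact ae_restrict_mem measurableSet_Ioo

lemma aestronglyMeasurable_of_continuousOn_prod_univ {E : Type*} [TopologicalSpace E]
    [TopologicalSpace.PseudoMetrizableSpace E] [SecondCountableTopology E] {s : Set ℝ}
    (hs : MeasurableSet s) (hμ : ∀ᵐ q ∂μ, q.1 ∈ s) {g : ℝ × Torus n → E}
    (hg : ContinuousOn g (s ×ˢ univ)) : AEStronglyMeasurable g μ := by
  rw [← Measure.restrict_eq_self_of_ae_mem (s := s ×ˢ univ)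
    (hμ.mono fun q hq => ⟨hq, mem_univ q.2⟩)]
  exact hg.aestronglyMeasurable (hs.prod MeasurableSet.univ)

section FiniteMeasure

variable [IsFiniteMeasure μ]

lemma memLp_timeDeriv (hμ : ∀ᵐ q ∂μ, q.1 ∈ Ioo 0 T) (hφ : φ ∈ C1Lip n T) (p : ℝ≥0∞) :
    MemLp (fun q => timeDeriv φ q.1 q.2) p μ := by
  obtain ⟨hC1, K, hK⟩ := hφ
  exact .of_bound (aestronglyMeasurable_of_continuousOn_prod_univ measurableSet_Ioo hμ
    (continuousOn_timeDeriv hC1 isOpen_Ioo)) K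
    (hμ.mono fun q hq => abs_timeDeriv_le hK (Icc_mem_nhds hq.1 hq.2) q.2)

lemma memLp_spaceGrad (hμ : ∀ᵐ q ∂μ, q.1 ∈ Ioo 0 T) (hφ : φ ∈ C1Lip n T) (p : ℝ≥0∞) :
    MemLp (fun q => spaceGrad φ q.1 q.2) p μ := by
  obtain ⟨hC1, K, hK⟩ := hφ
  exact .of_bound (aestronglyMeasurable_of_continuousOn_prod_univ measurableSet_Ioo hμ
    (continuousOn_spaceGrad hC1 isOpen_Ioo)) K
    (hμ.mono fun q hq => norm_spaceGrad_le hK (Ioo_subset_Icc_self hq) q.2)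

lemma integrable_timeDeriv (hμ : ∀ᵐ q ∂μ, q.1 ∈ Ioo 0 T) (hφ : φ ∈ C1Lip n T) :
    Integrable (fun q => timeDeriv φ q.1 q.2) μ :=
  memLp_one_iff_integrable.1 (memLp_timeDeriv hμ hφ 1)

lemma integrable_norm_sq_spaceGrad (hμ : ∀ᵐ q ∂μ, q.1 ∈ Ioo 0 T) (hφ : φ ∈ C1Lip n T) :
    Integrable (fun q => ‖spaceGrad φ q.1 q.2‖ ^ 2) μ :=
  (memLp_spaceGrad hμ hφ 2).integrable_norm_pow two_ne_zero

lemma hjIntegral_eq_add (hμ : ∀ᵐ q ∂μ, q.1 ∈ Ioo 0 T) (hφ : φ ∈ C1Lip n T) :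
    hjIntegral μ φ = ∫ q, timeDeriv φ q.1 q.2 ∂μ + (∫ q, ‖spaceGrad φ q.1 q.2‖ ^ 2 ∂μ) / 2 := by
  rw [hjIntegral, integral_add (integrable_timeDeriv hμ hφ)
    ((integrable_norm_sq_spaceGrad hμ hφ).div_const 2), integral_div]

variable (hμ : ∀ᵐ q ∂μ, q.1 ∈ Ioo 0 T) (hν : MeasurePreserving Prod.fst ν μ)
  (hE : kineticEnergy ν ≠ ∞) (hφ : φ ∈ C1Lip n T)
include hμ hν hE hφ

lemma integrable_inner_spaceGrad :
    Integrable (fun q : (ℝ × Torus n) × Vel n => inner ℝ q.2 (spaceGrad φ q.1.1 q.1.2)) ν := by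
  have hgrad := (memLp_spaceGrad hμ hφ 2).comp_measurePreserving hν
  exact ((memLp_velocity hE).norm.integrable_mul hgrad.norm).mono'
    ((memLp_velocity hE).aestronglyMeasurable.inner hgrad.aestronglyMeasurable)
    (Eventually.of_forall fun q => norm_inner_le_norm _ _)

lemma integrable_materialDeriv : Integrable (materialDeriv φ) ν :=
  (hν.integrable_comp_of_integrable (integrable_timeDeriv hμ hφ)).add
    (integrable_inner_spaceGrad hμ hν hE hφ)

lemma integrable_norm_sq_div_two_sub_inner : Integrable (fun q : (ℝ × Torus n) × Vel n =>
    ‖spaceGrad φ q.1.1 q.1.2‖ ^ 2 / 2 - inner ℝ q.2 (spaceGrad φ q.1.1 q.1.2)) ν :=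
  (hν.integrable_comp_of_integrable ((integrable_norm_sq_spaceGrad hμ hφ).div_const 2)).sub
    (integrable_inner_spaceGrad hμ hν hE hφ)

lemma hjIntegral_eq_integral_materialDeriv_add_youngDefect :
    hjIntegral μ φ = ∫ q, materialDeriv φ q ∂ν + youngDefect ν φ := by
  have hint := (integrable_timeDeriv hμ hφ).add ((integrable_norm_sq_spaceGrad hμ hφ).div_const 2)
  have hpush : hjIntegral μ φ =
      ∫ q, (timeDeriv φ q.1.1 q.1.2 + ‖spaceGrad φ q.1.1 q.1.2‖ ^ 2 / 2) ∂ν := by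
    rw [hjIntegral, ← hν.map_eq]
    exact integral_map hν.aemeasurable (hν.map_eq ▸ hint.aestronglyMeasurable)
  rw [hpush, youngDefect, ← integral_add (integrable_materialDeriv hμ hν hE hφ)
    (integrable_norm_sq_div_two_sub_inner hμ hν hE hφ)]
  refine integral_congr_ae (Eventually.of_forall fun q => ?_)
  simp only [materialDeriv]
  ring

lemma neg_youngDefect_le : -youngDefect ν φ ≤ (kineticEnergy ν).toReal / 2 := by
  rw [youngDefect, ← integral_neg, ← integral_norm_sq_velocity, ← integral_div]
  refine integral_mono (integrable_norm_sq_div_two_sub_inner hμ hν hE hφ).neg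
    (((memLp_velocity hE).integrable_norm_pow two_ne_zero).div_const 2) fun q => ?_
  have hsq := norm_sub_sq_real q.2 (spaceGrad φ q.1.1 q.1.2)
  linarith [sq_nonneg ‖q.2 - spaceGrad φ q.1.1 q.1.2‖]

end FiniteMeasure

end Measures

section Duality

-- `l` factors through `G`; extend from the range of `G` by Hahn–Banach, then use Riesz.
lemma exists_inner_eq_of_abs_le_norm {P E : Type*} [AddCommGroup P] [Module ℝ P]
    [NormedAddCommGroup E] [InnerProductSpace ℝ E] [CompleteSpace E] (G : P →ₗ[ℝ] E)
    (l : P →ₗ[ℝ] ℝ) {M : ℝ} (hM : 0 ≤ M) (h : ∀ p, |l p| ≤ M * ‖G p‖) :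
    ∃ w : E, ‖w‖ ≤ M ∧ ∀ p, inner ℝ w (G p) = l p := by
  obtain ⟨f, rfl⟩ : l ∈ LinearMap.range G.dualMap := by
    rw [LinearMap.range_dualMap_eq_dualAnnihilator_ker, Submodule.mem_dualAnnihilator]
    intro p hp
    simpa [LinearMap.mem_ker.1 hp] using h p
  have hbound : ∀ z : LinearMap.range G, ‖f.domRestrict (LinearMap.range G) z‖ ≤ M * ‖z‖ := by
    rintro ⟨_, p, rfl⟩
    exact h p
  obtain ⟨g, hg, hgnorm⟩ := exists_extension_norm_eq (LinearMap.range G)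
    ((f.domRestrict (LinearMap.range G)).mkContinuous M hbound)
  refine ⟨(InnerProductSpace.toDual ℝ E).symm g, ?_, fun p => ?_⟩
  · rw [LinearIsometryEquiv.norm_map, hgnorm]
    exact LinearMap.mkContinuous_norm_le _ hM hbound
  · rw [InnerProductSpace.toDual_symm_apply]
    exact hg ⟨G p, LinearMap.mem_range_self G p⟩

section GraphMeasure

variable {X : Type*} [MeasurableSpace X] {μ : Measure X} {w : X → Vel n}

/-- The measure `δ_{w(q)}(dv) μ(dq)` whose particle at `q` moves with velocity `w q`. -/
noncomputable def graphMeasure (μ : Measure X) (w : X → Vel n) : Measure (X × Vel n) :=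
  μ.map fun q => (q, w q)

lemma measurePreserving_fst_graphMeasure (hw : Measurable w) :
    MeasurePreserving Prod.fst (graphMeasure μ w) μ :=
  ⟨measurable_fst, (Measure.map_map measurable_fst (measurable_id.prodMk hw)).trans Measure.map_id⟩

lemma kineticEnergy_graphMeasure (hw : Measurable w) :
    kineticEnergy (graphMeasure μ w) = eLpNorm w 2 μ ^ 2 := by
  rw [kineticEnergy_eq_eLpNorm_sq, graphMeasure, eLpNorm_map_measure
    measurable_snd.aestronglyMeasurable (measurable_id'.prodMk hw).aemeasurable, Function.comp_def]

end GraphMeasure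

variable {T : ℝ} {φ : ℝ → Torus n → ℝ} {μ : Measure (ℝ × Torus n)}
  {ν : Measure ((ℝ × Torus n) × Vel n)}

lemma IsLifting.measurePreserving (hν : IsLifting T μ ν) : MeasurePreserving Prod.fst ν μ :=
  ⟨measurable_fst, hν.1⟩

section FiniteMeasure

variable [IsFiniteMeasure μ]

/-- The spatial gradient as a linear map from `C¹₀` to `L²(μ)`. -/
noncomputable def gradL2 (hT : 0 < T) (hμ : ∀ᵐ q ∂μ, q.1 ∈ Ioo 0 T) :
    c10Submodule n T →ₗ[ℝ] Lp (Vel n) 2 μ where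
  toFun φ := (memLp_spaceGrad hμ (C10_subset_C1Lip hT φ.2) 2).toLp _
  map_add' φ ψ := by
    rw [← MemLp.toLp_add]
    refine MemLp.toLp_congr _ _ (hμ.mono fun q hq => ?_)
    have hnhds := Icc_mem_nhds hq.1 hq.2
    exact spaceGrad_add (differentiableAt_space φ.2.1 hnhds q.2)
      (differentiableAt_space ψ.2.1 hnhds q.2)
  map_smul' c φ := by
    rw [RingHom.id_apply, ← MemLp.toLp_const_smul]
    exact MemLp.toLp_congr _ _ (Eventually.of_forall fun q => spaceGrad_smul c q.2)

/-- The functional `φ ↦ -∫ φ_t dμ` on `C¹₀`; the liftings of `μ` carried by a vector field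
`w ∈ L²(μ)` are those for which `∫ w · ∇ₓ φ dμ` is this functional. -/
noncomputable def negTimeDeriv (hT : 0 < T) (hμ : ∀ᵐ q ∂μ, q.1 ∈ Ioo 0 T) :
    c10Submodule n T →ₗ[ℝ] ℝ where
  toFun φ := -∫ q, timeDeriv φ.1 q.1 q.2 ∂μ
  map_add' φ ψ := by
    rw [← neg_add, ← integral_add (integrable_timeDeriv hμ (C10_subset_C1Lip hT φ.2))
      (integrable_timeDeriv hμ (C10_subset_C1Lip hT ψ.2))]
    refine congrArg _ (integral_congr_ae (hμ.mono fun q hq => ?_))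
    have hnhds := Icc_mem_nhds hq.1 hq.2
    exact timeDeriv_add (differentiableAt_time φ.2.1 hnhds q.2)
      (differentiableAt_time ψ.2.1 hnhds q.2)
  map_smul' c φ := by
    rw [RingHom.id_apply, smul_eq_mul, mul_neg, ← integral_const_mul]
    exact congrArg _ (integral_congr_ae (Eventually.of_forall fun q => timeDeriv_smul c q.2))

variable (hT : 0 < T) (hμ : ∀ᵐ q ∂μ, q.1 ∈ Ioo 0 T)

lemma ae_gradL2_eq (φ : c10Submodule n T) :
    gradL2 hT hμ φ =ᵐ[μ] fun q => spaceGrad φ.1 q.1 q.2 :=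
  (memLp_spaceGrad hμ (C10_subset_C1Lip hT φ.2) 2).coeFn_toLp

lemma norm_sq_gradL2 (φ : c10Submodule n T) :
    ‖gradL2 hT hμ φ‖ ^ 2 = ∫ q, ‖spaceGrad φ.1 q.1 q.2‖ ^ 2 ∂μ := by
  rw [← real_inner_self_eq_norm_sq, L2.inner_def]
  refine integral_congr_ae ((ae_gradL2_eq hT hμ φ).mono fun q hq => ?_)
  simp only [hq, real_inner_self_eq_norm_sq]

lemma abs_negTimeDeriv_le_of_quotient_le {Q : ℝ≥0∞} (hQ : Q ≠ ∞) {φ : c10Submodule n T}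
    (hφ : quotient μ φ.1 ≤ Q) :
    |negTimeDeriv hT hμ φ| ≤ √Q.toReal * ‖gradL2 hT hμ φ‖ := by
  rw [quotient, ENNReal.div_le_iff_le_mul (Or.inr hQ) (Or.inl ENNReal.ofReal_ne_top),
    ← norm_sq_gradL2 hT hμ φ, ← ENNReal.ofReal_toReal hQ,
    ← ENNReal.ofReal_mul ENNReal.toReal_nonneg, ENNReal.ofReal_le_ofReal_iff (by positivity)] at hφ
  refine abs_le_of_sq_le_sq ?_ (by positivity)
  rw [mul_pow, Real.sq_sqrt ENNReal.toReal_nonneg]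
  exact (neg_sq _).trans_le hφ

lemma isLifting_graphMeasure {w : Lp (Vel n) 2 μ}
    (hw : ∀ φ, inner ℝ w (gradL2 hT hμ φ) = negTimeDeriv hT hμ φ) :
    IsLifting T μ (graphMeasure μ w) := by
  have hmeas : Measurable w := (Lp.stronglyMeasurable w).measurable
  have hfst := measurePreserving_fst_graphMeasure (μ := μ) hmeas
  have hE : kineticEnergy (graphMeasure μ w) ≠ ∞ := by
    rw [kineticEnergy_graphMeasure hmeas]
    exact ENNReal.pow_ne_top (Lp.eLpNorm_ne_top w)
  refine ⟨hfst.map_eq, fun φ hφ => ?_⟩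
  have hL := C10_subset_C1Lip hT hφ
  have hmat := integrable_materialDeriv hμ hfst hE hL
  have hgrad := ae_gradL2_eq hT hμ ⟨φ, hφ⟩
  have hinner : Integrable (fun q => inner ℝ (w q) (spaceGrad φ q.1 q.2)) μ :=
    (L2.integrable_inner (𝕜 := ℝ) w (gradL2 hT hμ ⟨φ, hφ⟩)).congr
      (hgrad.mono fun q hq => congrArg _ hq)
  have hwφ : ∫ q, inner ℝ (w q) (spaceGrad φ q.1 q.2) ∂μ = -∫ q, timeDeriv φ q.1 q.2 ∂μ := by
    rw [← show _ = -∫ q, timeDeriv φ q.1 q.2 ∂μ from hw ⟨φ, hφ⟩, L2.inner_def]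
    exact integral_congr_ae (hgrad.mono fun q hq => congrArg _ hq.symm)
  refine ⟨hmat, ?_⟩
  change ∫ q, materialDeriv φ q ∂graphMeasure μ w = 0
  rw [graphMeasure, integral_map (measurable_id'.prodMk hmeas).aemeasurable
    hmat.aestronglyMeasurable]
  simp only [materialDeriv]
  rw [integral_add (integrable_timeDeriv hμ hL) hinner, hwφ, add_neg_cancel]

include hT hμ in
lemma exists_isLifting_kineticEnergy_le {Q : ℝ≥0∞} (hQ : Q ≠ ∞)
    (hquot : ∀ φ ∈ C10 n T, quotient μ φ ≤ Q) : ∃ ν, IsLifting T μ ν ∧ kineticEnergy ν ≤ Q := by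
  obtain ⟨w, hwQ, hw⟩ := exists_inner_eq_of_abs_le_norm (gradL2 hT hμ) (negTimeDeriv hT hμ)
    (Real.sqrt_nonneg Q.toReal) fun φ =>
      abs_negTimeDeriv_le_of_quotient_le hT hμ hQ (hquot φ.1 φ.2)
  refine ⟨graphMeasure μ w, isLifting_graphMeasure hT hμ hw, ?_⟩
  rw [kineticEnergy_graphMeasure (Lp.stronglyMeasurable w).measurable, ← Lp.enorm_def,
    ← ofReal_norm, ← ENNReal.ofReal_pow (norm_nonneg w)]
  exact ENNReal.ofReal_le_of_le_toReal
    ((pow_le_pow_left₀ (norm_nonneg w) hwQ 2).trans_eq (Real.sq_sqrt ENNReal.toReal_nonneg))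

include hT hμ in
lemma hjIntegral_smul (c : ℝ) (hφ : φ ∈ C10 n T) :
    hjIntegral μ (c • φ) = c * ∫ q, timeDeriv φ q.1 q.2 ∂μ +
      c ^ 2 * (∫ q, ‖spaceGrad φ q.1 q.2‖ ^ 2 ∂μ) / 2 := by
  have hc : c • φ ∈ C10 n T := (c10Submodule n T).smul_mem c hφ
  simp only [hjIntegral_eq_add hμ (C10_subset_C1Lip hT hc), timeDeriv_smul, spaceGrad_smul,
    norm_smul, mul_pow, Real.norm_eq_abs, sq_abs, integral_const_mul]

end FiniteMeasure

lemma hNorm_two_sq (T : ℝ) (μ : Measure (ℝ × Torus n)) :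
    hNorm T 2 μ ^ 2 = ⨅ (ν) (_ : IsLifting T μ ν), kineticEnergy ν := by
  rw [← ENNReal.rpow_two, ← ENNReal.orderIsoRpow_apply 2 two_pos, hNorm, OrderIso.map_iInf₂]
  simp only [ENNReal.orderIsoRpow_apply, ← ENNReal.rpow_mul, one_div, kineticEnergy]
  norm_num

lemma half_mul_ofReal_two_mul (s : ℝ) :
    (1 / 2 : ℝ≥0∞) * ENNReal.ofReal (2 * s) = ENNReal.ofReal s := by
  rw [ENNReal.ofReal_mul zero_le_two, ENNReal.ofReal_ofNat, ← mul_assoc, one_div,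
    ENNReal.inv_mul_cancel two_ne_zero ENNReal.ofNat_ne_top, one_mul]

lemma coe_le_half_hNorm_sq {a : ℝ}
    (h : ∀ ν, IsLifting T μ ν → kineticEnergy ν ≠ ∞ → a ≤ (kineticEnergy ν).toReal / 2) :
    (a : EReal) ≤ ((1 / 2 : ℝ≥0∞) * hNorm T 2 μ ^ 2 : ℝ≥0∞) := by
  have hle : ENNReal.ofReal (2 * a) ≤ hNorm T 2 μ ^ 2 := by
    rw [hNorm_two_sq]
    refine le_iInf₂ fun ν hν => ?_
    rcases eq_or_ne (kineticEnergy ν) ∞ with htop | hE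
    · exact htop ▸ le_top
    · exact ENNReal.ofReal_le_of_le_toReal (by linarith [h ν hν hE])
  have hhalf := half_mul_ofReal_two_mul a ▸ mul_le_mul_right hle (1 / 2)
  refine le_trans ?_ (EReal.coe_ennreal_le_coe_ennreal_iff.2 hhalf)
  rw [EReal.coe_ennreal_ofReal]
  exact_mod_cast le_max_left a 0

lemma neg_iInf_le_iff {ι : Type*} {s : Set ι} {F : ι → ℝ} {a : EReal} :
    -(⨅ i ∈ s, (F i : EReal)) ≤ a ↔ ∀ i ∈ s, ((-F i : ℝ) : EReal) ≤ a := by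
  simp only [EReal.neg_le, le_iInf_iff, EReal.coe_neg]

section FiniteMeasure

variable [IsFiniteMeasure μ] (hT : 0 < T) (hμ : ∀ᵐ q ∂μ, q.1 ∈ Ioo 0 T)
include hT hμ

lemma neg_hjIntegral_le_half_hNorm_sq (hφ : φ ∈ C10 n T) :
    ((-hjIntegral μ φ : ℝ) : EReal) ≤ ((1 / 2 : ℝ≥0∞) * hNorm T 2 μ ^ 2 : ℝ≥0∞) := by
  refine coe_le_half_hNorm_sq fun ν hν hE => ?_
  have hL := C10_subset_C1Lip hT hφ
  have hzero : ∫ q, materialDeriv φ q ∂ν = 0 := (hν.2 φ hφ).2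
  rw [hjIntegral_eq_integral_materialDeriv_add_youngDefect hμ hν.measurePreserving hE hL, hzero,
    zero_add]
  exact neg_youngDefect_le hμ hν.measurePreserving hE hL

lemma hNorm_sq_le_iSup_quotient : hNorm T 2 μ ^ 2 ≤ ⨆ φ ∈ C10 n T, quotient μ φ := by
  rcases eq_or_ne (⨆ φ ∈ C10 n T, quotient μ φ) ∞ with htop | hQ
  · exact htop ▸ le_top
  · obtain ⟨ν, hν, hE⟩ := exists_isLifting_kineticEnergy_le hT hμ hQ fun φ hφ =>
      le_iSup₂ (f := fun φ (_ : φ ∈ C10 n T) => quotient μ φ) φ hφ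
    rw [hNorm_two_sq]
    exact (iInf₂_le ν hν).trans hE

lemma quotient_le_of_neg_hjIntegral_le {s : ℝ} (hs : ∀ φ ∈ C10 n T, -hjIntegral μ φ ≤ s)
    (hφ : φ ∈ C10 n T) : quotient μ φ ≤ ENNReal.ofReal (2 * s) := by
  have hs0 : 0 ≤ s := by
    have h0 := hs _ ((c10Submodule n T).smul_mem 0 hφ)
    rw [hjIntegral_smul hT hμ 0 hφ] at h0
    simpa using h0
  have hdiscrim := discrim_le_zero (a := (∫ q, ‖spaceGrad φ q.1 q.2‖ ^ 2 ∂μ) / 2)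
    (b := ∫ q, timeDeriv φ q.1 q.2 ∂μ) (c := s) fun c => by
      have hc := hs _ ((c10Submodule n T).smul_mem c hφ)
      rw [hjIntegral_smul hT hμ c hφ] at hc
      linarith
  rw [quotient, ENNReal.div_le_iff_le_mul (Or.inr ENNReal.ofReal_ne_top)
    (Or.inl ENNReal.ofReal_ne_top), ← ENNReal.ofReal_mul (by positivity)]
  rw [discrim] at hdiscrim
  exact ENNReal.ofReal_le_ofReal (by linarith)

lemma half_iSup_quotient_le : (((1 / 2 : ℝ≥0∞) * ⨆ φ ∈ C10 n T, quotient μ φ : ℝ≥0∞) : EReal) ≤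
    -⨅ φ ∈ C10 n T, ((hjIntegral μ φ : ℝ) : EReal) := by
  set X : EReal := -⨅ φ ∈ C10 n T, ((hjIntegral μ φ : ℝ) : EReal)
  have hX : ∀ φ ∈ C10 n T, ((-hjIntegral μ φ : ℝ) : EReal) ≤ X := neg_iInf_le_iff.1 le_rfl
  have hX0 : 0 ≤ X := by
    have hzero := (c10Submodule n T).zero_mem
    have h0 := hX _ ((c10Submodule n T).smul_mem 0 hzero)
    rw [hjIntegral_smul hT hμ 0 hzero] at h0
    simpa using h0
  rcases eq_or_ne X ⊤ with htop | htop
  · exact htop ▸ le_top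
  lift X to ℝ using ⟨htop, ne_bot_of_le_ne_bot EReal.zero_ne_bot hX0⟩ with s
  have hsup : ⨆ φ ∈ C10 n T, quotient μ φ ≤ ENNReal.ofReal (2 * s) :=
    iSup₂_le fun φ hφ => quotient_le_of_neg_hjIntegral_le hT hμ
      (fun ψ hψ => EReal.coe_le_coe_iff.1 (hX ψ hψ)) hφ
  have hhalf := half_mul_ofReal_two_mul s ▸ mul_le_mul_right hsup (1 / 2)
  refine (EReal.coe_ennreal_le_coe_ennreal_iff.2 hhalf).trans_eq ?_
  rw [EReal.coe_ennreal_ofReal, max_eq_left (EReal.coe_nonneg.1 hX0)]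

lemma half_hNorm_sq_eq_neg_iInf_hjIntegral :
    (((1 / 2 : ℝ≥0∞) * hNorm T 2 μ ^ 2 : ℝ≥0∞) : EReal) =
      -⨅ φ ∈ C10 n T, ((hjIntegral μ φ : ℝ) : EReal) := by
  refine le_antisymm ?_ (neg_iInf_le_iff.2 fun φ hφ => neg_hjIntegral_le_half_hNorm_sq hT hμ hφ)
  refine le_trans ?_ (half_iSup_quotient_le hT hμ)
  exact EReal.coe_ennreal_le_coe_ennreal_iff.2
    (mul_le_mul_right (hNorm_sq_le_iSup_quotient hT hμ) _)

lemma hNorm_sq_eq_iSup_quotient : hNorm T 2 μ ^ 2 = ⨆ φ ∈ C10 n T, quotient μ φ := by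
  refine le_antisymm (hNorm_sq_le_iSup_quotient hT hμ) ?_
  have hhalf := half_iSup_quotient_le hT hμ
  rw [← half_hNorm_sq_eq_neg_iInf_hjIntegral hT hμ, EReal.coe_ennreal_le_coe_ennreal_iff] at hhalf
  rwa [ENNReal.mul_le_mul_iff_right (by simp) (by simp)] at hhalf

end FiniteMeasure

end Duality

section DuBoisReymond

open scoped ContDiff

variable {E : Type*} [NormedAddCommGroup E] [NormedSpace ℝ E] {a b : ℝ}

lemma exists_subset_Icc_of_isCompact_of_subset_Ioo {K : Set ℝ} (hK : IsCompact K) (hab : a < b)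
    (hKab : K ⊆ Ioo a b) : ∃ c d, a < c ∧ d < b ∧ K ⊆ Icc c d := by
  rcases K.eq_empty_or_nonempty with rfl | hne
  · exact ⟨b, a, hab, hab, empty_subset _⟩
  · exact ⟨sInf K, sSup K, (hKab (hK.sInf_mem hne)).1, (hKab (hK.sSup_mem hne)).2,
      fun t ht => ⟨csInf_le hK.bddBelow ht, le_csSup hK.bddAbove ht⟩⟩

lemma tsupport_primitive_subset {g : ℝ → ℝ} (hg : HasCompactSupport g) (hab : a < b)
    (hsupp : tsupport g ⊆ Ioo a b) (hmean : ∫ t, g t = 0) :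
    tsupport (fun t => ∫ s in a..t, g s) ⊆ Ioo a b := by
  obtain ⟨c, d, hac, hdb, hsub⟩ := exists_subset_Icc_of_isCompact_of_subset_Ioo hg hab hsupp
  have hzero : ∀ s ∉ Icc c d, g s = 0 := fun s hs =>
    image_eq_zero_of_notMem_tsupport fun h => hs (hsub h)
  refine (closure_minimal (Function.support_subset_iff'.2 fun t ht => ?_) isClosed_Icc).trans
    (Icc_subset_Ioo hac hdb)
  rcases lt_or_ge t c with htc | hct
  · refine intervalIntegral.integral_zero_ae (Eventually.of_forall fun s hs => hzero s fun h => ?_)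
    exact (h.1.trans hs.2).not_gt (max_lt hac htc)
  · have hdt : d < t := lt_of_not_ge fun h => ht ⟨hct, h⟩
    rw [intervalIntegral.integral_eq_integral_of_support_subset, hmean]
    refine Function.support_subset_iff'.2 fun s hs => hzero s fun h => hs ?_
    exact ⟨hac.trans_le h.1, h.2.trans hdt.le⟩

lemma exists_contDiff_deriv_eq {g : ℝ → ℝ} (hg : ContDiff ℝ ∞ g) (hcomp : HasCompactSupport g)
    (hab : a < b) (hsupp : tsupport g ⊆ Ioo a b) (hmean : ∫ t, g t = 0) :
    ∃ η : ℝ → ℝ, ContDiff ℝ ∞ η ∧ tsupport η ⊆ Ioo a b ∧ deriv η = g := by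
  have hderiv : deriv (fun t => ∫ s in a..t, g s) = g :=
    funext fun t => hg.continuous.deriv_integral g a t
  refine ⟨fun t => ∫ s in a..t, g s, contDiff_infty_iff_deriv.2 ⟨fun t => ?_, hderiv.symm ▸ hg⟩,
    tsupport_primitive_subset hcomp hab hsupp hmean, hderiv⟩
  exact (hg.continuous.integral_hasStrictDerivAt a t).hasDerivAt.differentiableAt

lemma hasCompactSupport_of_tsupport_subset_Ioo {θ : ℝ → ℝ} (h : tsupport θ ⊆ Ioo a b) :
    HasCompactSupport θ :=
  .of_support_subset_isCompact isCompact_Icc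
    ((subset_tsupport θ).trans (h.trans Ioo_subset_Icc_self))

lemma integrable_smul_of_tsupport_subset {f : ℝ → E} {s : Set ℝ} (hf : LocallyIntegrableOn f s)
    {θ : ℝ → ℝ} (hθ : Continuous θ) (hcomp : HasCompactSupport θ) (hsupp : tsupport θ ⊆ s) :
    Integrable fun t => θ t • f t := by
  refine (integrableOn_iff_integrable_of_support_subset
    ((Function.support_smul_subset_left θ f).trans (subset_tsupport θ))).1 ?_
  exact (hf.integrableOn_compact_subset hsupp hcomp).continuousOn_smul hθ.continuousOn hcomp

lemma exists_contDiff_integral_eq_one (hab : a < b) :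
    ∃ ρ : ℝ → ℝ, ContDiff ℝ ∞ ρ ∧ HasCompactSupport ρ ∧ tsupport ρ ⊆ Ioo a b ∧ ∫ t, ρ t = 1 := by
  let B : ContDiffBump ((a + b) / 2) :=
    ⟨(b - a) / 8, (b - a) / 4, by linarith, by linarith⟩
  refine ⟨B.normed volume, B.contDiff_normed, B.hasCompactSupport_normed, ?_, B.integral_normed⟩
  rw [B.tsupport_normed_eq, Real.closedBall_eq_Icc]
  exact Icc_subset_Ioo (by simp only [B]; linarith) (by simp only [B]; linarith)

-- With `∫ ρ = 1`, the function `θ - (∫ θ) ρ` is the derivative of a test function, and so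
-- `∫ θ f = ∫ θ c` with `c = ∫ ρ f`.
lemma exists_ae_eq_const_of_integral_deriv_smul_eq_zero [CompleteSpace E] (hab : a < b) {f : ℝ → E}
    (hf : LocallyIntegrableOn f (Ioo a b))
    (h : ∀ η : ℝ → ℝ, ContDiff ℝ ∞ η → tsupport η ⊆ Ioo a b → ∫ t, deriv η t • f t = 0) :
    ∃ c, ∀ᵐ t, t ∈ Ioo a b → f t = c := by
  obtain ⟨ρ, hρ, hρcomp, hρsupp, hρint⟩ := exists_contDiff_integral_eq_one hab
  have hρf := integrable_smul_of_tsupport_subset hf hρ.continuous hρcomp hρsupp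
  have hρ1 : Integrable ρ := hρ.continuous.integrable_of_hasCompactSupport hρcomp
  set c := ∫ t, ρ t • f t
  have hc : ∀ᵐ t, t ∈ Ioo a b → f t - c = 0 := by
    have hfc : LocallyIntegrableOn (fun t => f t - c) (Ioo a b) :=
      hf.sub (locallyIntegrableOn_const c)
    refine isOpen_Ioo.ae_eq_zero_of_integral_contDiff_smul_eq_zero hfc fun θ hθ hθcomp hθsupp => ?_
    have hθf := integrable_smul_of_tsupport_subset hf hθ.continuous hθcomp hθsupp
    have hθint : Integrable θ := hθ.continuous.integrable_of_hasCompactSupport hθcomp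
    have hsupp : tsupport (θ - (∫ s, θ s) • ρ) ⊆ Ioo a b :=
      (tsupport_sub _ _).trans (union_subset hθsupp
        ((tsupport_smul_subset_right (Function.const ℝ (∫ s, θ s)) ρ).trans hρsupp))
    obtain ⟨η, hη, hηsupp, hderiv⟩ := exists_contDiff_deriv_eq
      (hθ.sub (hρ.const_smul (∫ s, θ s))) (hasCompactSupport_of_tsupport_subset_Ioo hsupp) hab hsupp
      (by simp [integral_sub hθint (hρ1.const_mul _), integral_const_mul, hρint])
    have hη0 := h η hη hηsupp
    simp only [hderiv, sub_smul, smul_assoc] at hη0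
    rw [integral_sub hθf (hρf.fun_smul _), integral_smul] at hη0
    simp only [smul_sub]
    rw [integral_sub hθf (hθint.smul_const c), integral_smul_const, hη0]
  exact ⟨c, hc.mono fun t ht hmem => sub_eq_zero.1 (ht hmem)⟩

end DuBoisReymond

section Truncation

variable {α : Type*} [MeasurableSpace α] {ν : Measure α} {τ : α → ℝ} {g : α → ℝ}

lemma continuous_setIntegral_le (hτ : Measurable τ) (hne : ∀ t, ∀ᵐ q ∂ν, τ q ≠ t)
    (hg : Integrable g ν) : Continuous fun t => ∫ q in {q | τ q ≤ t}, g q ∂ν := by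
  have hmeas : ∀ t, MeasurableSet {q | τ q ≤ t} := fun t => measurableSet_le hτ measurable_const
  simp_rw [← integral_indicator (hmeas _)]
  refine continuous_iff_continuousAt.2 fun t => continuousAt_of_dominated
    (Eventually.of_forall fun s => hg.aestronglyMeasurable.indicator (hmeas s))
    (Eventually.of_forall fun s => Eventually.of_forall fun q => norm_indicator_le_norm_self _ _)
    hg.norm ((hne t).mono fun q hq => ?_)
  rcases hq.lt_or_gt with hlt | hgt
  · exact continuousAt_const.congr ((lt_mem_nhds hlt).mono fun s hs =>
      (indicator_of_mem (s := {q | τ q ≤ s}) hs.le g).symm)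
  · exact continuousAt_const.congr ((gt_mem_nhds hgt).mono fun s hs =>
      (indicator_of_notMem (s := {q | τ q ≤ s}) hs.not_ge g).symm)

lemma integral_deriv_mul_setIntegral_le [SFinite ν] (hτ : Measurable τ) (hg : Integrable g ν)
    {η : ℝ → ℝ} (hη : ContDiff ℝ 1 η) (hcomp : HasCompactSupport η) :
    ∫ t, deriv η t * ∫ q in {q | τ q ≤ t}, g q ∂ν = -∫ q, η (τ q) * g q ∂ν := by
  have hmeas : MeasurableSet {p : ℝ × α | τ p.2 ≤ p.1} :=
    measurableSet_le (hτ.comp measurable_snd) measurable_fst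
  have hint : Integrable (fun p : ℝ × α => deriv η p.1 * g p.2) (volume.prod ν) :=
    ((hη.continuous_deriv le_rfl).integrable_of_hasCompactSupport hcomp.deriv).mul_prod hg
  have hind : ∀ t q, {q | τ q ≤ t}.indicator (fun q => deriv η t * g q) q =
      (Ici (τ q)).indicator (fun t => deriv η t * g q) t := fun t q => rfl
  calc ∫ t, deriv η t * ∫ q in {q | τ q ≤ t}, g q ∂ν
      = ∫ t, ∫ q, {q | τ q ≤ t}.indicator (fun q => deriv η t * g q) q ∂ν := by
        refine integral_congr_ae (Eventually.of_forall fun t => ?_)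
        simp only [integral_indicator (measurableSet_le hτ measurable_const), integral_const_mul]
    _ = ∫ q, (∫ t, {q | τ q ≤ t}.indicator (fun q => deriv η t * g q) q) ∂ν :=
        integral_integral_swap (f := fun t => {q | τ q ≤ t}.indicator fun q => deriv η t * g q)
          (hint.indicator hmeas)
    _ = ∫ q, -(η (τ q) * g q) ∂ν := by
        refine integral_congr_ae (Eventually.of_forall fun q => ?_)
        simp only [hind, integral_indicator measurableSet_Ici, integral_mul_const,
          integral_Ici_eq_integral_Ioi, hcomp.integral_Ioi_deriv_eq hη, neg_mul]
    _ = -∫ q, η (τ q) * g q ∂ν := integral_neg _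

end Truncation

section Transport

/-- The integral of the material derivative of `φ` over the times up to `t`: the variation of
`∫ φ(t,x) μ_(t)(dx)` from the initial time to `t`. -/
noncomputable def materialPrimitive (ν : Measure ((ℝ × Torus n) × Vel n)) (φ : ℝ → Torus n → ℝ)
    (t : ℝ) : ℝ :=
  ∫ q in {q | q.1.1 ≤ t}, materialDeriv φ q ∂ν

variable {T : ℝ} {φ : ℝ → Torus n → ℝ} {η : ℝ → ℝ} {μ : Measure (ℝ × Torus n)}
  {ν : Measure ((ℝ × Torus n) × Vel n)} {κ : Kernel ℝ (Torus n)}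

lemma materialPrimitive_zero (hν : ∀ᵐ q ∂ν, q.1.1 ∈ Ioo 0 T) : materialPrimitive ν φ 0 = 0 :=
  setIntegral_measure_zero _ <| measure_eq_zero_iff_ae_notMem.2 <|
    hν.mono fun _ hq hle => not_lt.2 hle hq.1

lemma materialPrimitive_final (hν : ∀ᵐ q ∂ν, q.1.1 ∈ Ioo 0 T) :
    materialPrimitive ν φ T = ∫ q, materialDeriv φ q ∂ν := by
  have hle : ∀ᵐ q ∂ν, q ∈ {q : (ℝ × Torus n) × Vel n | q.1.1 ≤ T} := hν.mono fun _ hq => hq.2.le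
  rw [materialPrimitive, Measure.restrict_eq_self_of_ae_mem hle]

lemma ae_time_ne (hμ : μ ∈ Orbits n T) (hν : MeasurePreserving Prod.fst ν μ) (t : ℝ) :
    ∀ᵐ q ∂ν, q.1.1 ≠ t :=
  ((measurePreserving_time_of_mem_Orbits hμ).comp hν).quasiMeasurePreserving.ae
    (Measure.ae_ne _ t)

lemma integrable_of_mem_C1Lip [IsFiniteMeasure μ] (hμ : ∀ᵐ q ∂μ, q.1 ∈ Ioo 0 T)
    (hφ : φ ∈ C1Lip n T) : Integrable (fun q => φ q.1 q.2) μ := by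
  obtain ⟨-, K, hK⟩ := hφ
  have hcont := continuousOn_uncurry hK
  obtain ⟨C, hC⟩ := (isCompact_Icc.prod isCompact_univ).exists_bound_of_continuousOn hcont
  have hIcc : ∀ᵐ q ∂μ, q.1 ∈ Icc 0 T := hμ.mono fun _ hq => Ioo_subset_Icc_self hq
  exact .of_bound (aestronglyMeasurable_of_continuousOn_prod_univ measurableSet_Icc hIcc hcont) C
    (hIcc.mono fun q hq => hC q ⟨hq, mem_univ q.2⟩)

lemma integrable_deriv_mul [IsFiniteMeasure μ] (hμ : ∀ᵐ q ∂μ, q.1 ∈ Ioo 0 T)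
    (hφ : φ ∈ C1Lip n T) (hη : ContDiff ℝ 1 η) (hcomp : HasCompactSupport η) :
    Integrable (fun q => deriv η q.1 * φ q.1 q.2) μ := by
  have hderiv := hη.continuous_deriv le_rfl
  obtain ⟨C, hC⟩ := hcomp.deriv.exists_bound_of_continuous hderiv
  exact (integrable_of_mem_C1Lip hμ hφ).bdd_mul (c := C)
    (hderiv.comp continuous_fst).aestronglyMeasurable (Eventually.of_forall fun q => hC q.1)

lemma integral_deriv_mul_eq_neg [IsFiniteMeasure μ] (hμ : ∀ᵐ q ∂μ, q.1 ∈ Ioo 0 T)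
    (hν : IsLifting T μ ν) (hE : kineticEnergy ν ≠ ∞) (hφ : φ ∈ C1Lip n T)
    (hη : ContDiff ℝ 1 η) (hsupp : tsupport η ⊆ Ioo 0 T) :
    ∫ q, deriv η q.1 * φ q.1 q.2 ∂μ = -∫ q, η q.1.1 * materialDeriv φ q ∂ν := by
  have hcomp := hasCompactSupport_of_tsupport_subset_Ioo hsupp
  have hfst := hν.measurePreserving
  have hintμ := integrable_deriv_mul hμ hφ hη hcomp
  have hintν : Integrable (fun q => η q.1.1 * materialDeriv φ q) ν := by
    obtain ⟨C, hC⟩ := hcomp.exists_bound_of_continuous hη.continuous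
    exact (integrable_materialDeriv hμ hfst hE hφ).bdd_mul (c := C)
      (hη.continuous.comp (continuous_fst.comp continuous_fst)).aestronglyMeasurable
      (Eventually.of_forall fun q => hC q.1.1)
  have hpush : ∫ q, deriv η q.1 * φ q.1 q.2 ∂μ = ∫ q, deriv η q.1.1 * φ q.1.1 q.1.2 ∂ν := by
    rw [← hfst.map_eq]
    exact integral_map hfst.aemeasurable (hfst.map_eq ▸ hintμ.aestronglyMeasurable)
  have hleibniz : ∀ᵐ q ∂ν, deriv η q.1.1 * φ q.1.1 q.1.2 + η q.1.1 * materialDeriv φ q =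
      materialDeriv (fun t x => η t * φ t x) q := by
    filter_upwards [hfst.quasiMeasurePreserving.ae hμ] with q hq
    rw [materialDeriv, materialDeriv, timeDeriv_mul (hη.differentiable one_ne_zero).differentiableAt
      (differentiableAt_time hφ.1 (Ioo_mem_nhds hq.1 hq.2) q.1.2), spaceGrad_mul,
      real_inner_smul_right]
    ring
  have hintderiv : Integrable (fun q => deriv η q.1.1 * φ q.1.1 q.1.2) ν :=
    hfst.integrable_comp_of_integrable hintμ
  rw [hpush, eq_neg_iff_add_eq_zero, ← integral_add hintderiv hintν, integral_congr_ae hleibniz]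
  exact (hν.2 _ (mul_mem_C10 hη hsupp hφ.1)).2

lemma integral_deriv_mul_integral_kernel (hκ : Decomposes T μ κ) (hφ : φ ∈ C1Lip n T)
    (hη : ContDiff ℝ 1 η) (hsupp : tsupport η ⊆ Ioo 0 T) :
    ∫ t, deriv η t * ∫ x, φ t x ∂κ t = ∫ q, deriv η q.1 * φ q.1 q.2 ∂μ := by
  have hμ : μ ∈ Orbits n T := ⟨κ, hκ⟩
  have := isFiniteMeasure_of_mem_Orbits hμ
  obtain ⟨hmarkov, hdec⟩ := hκ
  have hint := integrable_deriv_mul (ae_mem_Ioo_of_mem_Orbits hμ) hφ hη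
    (hasCompactSupport_of_tsupport_subset_Ioo hsupp)
  rw [hdec] at hint ⊢
  rw [Measure.integral_compProd hint,
    ← setIntegral_eq_integral_of_forall_compl_eq_zero (s := Icc 0 T)]
  · simp only [integral_const_mul]
  · intro t ht
    have hderiv : deriv η t = 0 := image_eq_zero_of_notMem_tsupport fun h =>
      ht (Ioo_subset_Icc_self (hsupp (tsupport_deriv_subset h)))
    rw [hderiv, zero_mul]

variable (hT : 0 < T) (hκ : Decomposes T μ κ) (hν : IsLifting T μ ν)
  (hE : kineticEnergy ν ≠ ∞) (hφ : φ ∈ C1Lip n T)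
include hκ hν hE hφ

lemma continuous_materialPrimitive : Continuous (materialPrimitive ν φ) := by
  have hμ : μ ∈ Orbits n T := ⟨κ, hκ⟩
  have := isFiniteMeasure_of_mem_Orbits hμ
  exact continuous_setIntegral_le measurable_fst.fst (ae_time_ne hμ hν.measurePreserving)
    (integrable_materialDeriv (ae_mem_Ioo_of_mem_Orbits hμ) hν.measurePreserving hE hφ)

include hT

lemma exists_ae_integral_eq_materialPrimitive_add :
    ∃ c, ∀ᵐ t, t ∈ Ioo 0 T → ∫ x, φ t x ∂κ t = materialPrimitive ν φ t + c := by
  have hμ : μ ∈ Orbits n T := ⟨κ, hκ⟩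
  have := isFiniteMeasure_of_mem_Orbits hμ
  have hIoo := ae_mem_Ioo_of_mem_Orbits hμ
  have hfst := hν.measurePreserving
  have : IsFiniteMeasure (ν.map Prod.fst) := by rwa [hfst.map_eq]
  have : IsFiniteMeasure ν := Measure.isFiniteMeasure_of_map hfst.aemeasurable
  have hmarkov := hκ.1
  have hmean : LocallyIntegrableOn (fun t => ∫ x, φ t x ∂κ t) (Ioo 0 T) := by
    have hint := integrable_of_mem_C1Lip hIoo hφ
    rw [hκ.2] at hint
    have hintOn : IntegrableOn (fun t => ∫ x, φ t x ∂κ t) (Icc 0 T) := hint.integral_compProd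
    exact (hintOn.mono_set Ioo_subset_Icc_self).locallyIntegrableOn
  have hprim : LocallyIntegrableOn (materialPrimitive ν φ) (Ioo 0 T) :=
    (continuous_materialPrimitive hκ hν hE hφ).locallyIntegrable.locallyIntegrableOn _
  have hweak : ∀ η : ℝ → ℝ, ContDiff ℝ 1 η → tsupport η ⊆ Ioo 0 T →
      ∫ t, deriv η t * (∫ x, φ t x ∂κ t - materialPrimitive ν φ t) = 0 := fun η hη hsupp => by
    have hcomp := hasCompactSupport_of_tsupport_subset_Ioo hsupp
    have hderiv := hη.continuous_deriv le_rfl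
    have hdsupp := tsupport_deriv_subset.trans hsupp
    have hintmean : Integrable fun t => deriv η t * ∫ x, φ t x ∂κ t :=
      integrable_smul_of_tsupport_subset hmean hderiv hcomp.deriv hdsupp
    have hintprim : Integrable fun t => deriv η t * materialPrimitive ν φ t :=
      integrable_smul_of_tsupport_subset hprim hderiv hcomp.deriv hdsupp
    simp only [mul_sub]
    rw [integral_sub hintmean hintprim,
      integral_deriv_mul_integral_kernel hκ hφ hη hsupp,
      integral_deriv_mul_eq_neg hIoo hν hE hφ hη hsupp]
    unfold materialPrimitive
    rw [integral_deriv_mul_setIntegral_le measurable_fst.fst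
        (integrable_materialDeriv hIoo hfst hE hφ) hη hcomp, sub_self]
  obtain ⟨c, hc⟩ := exists_ae_eq_const_of_integral_deriv_smul_eq_zero hT (hmean.sub hprim)
    fun η hη hsupp => hweak η (hη.of_le (mod_cast le_top)) hsupp
  exact ⟨c, hc.mono fun t ht h => sub_eq_iff_eq_add'.1 (ht h)⟩

end Transport

section WeakContinuity

/-- Weak continuity on `s` of a family of measures on the torus, as in the definition of `Lam`. -/
def WeaklyContinuousOn (κ : Kernel ℝ (Torus n)) (s : Set ℝ) : Prop :=
  ∀ f : C(Torus n, ℝ), ContinuousOn (fun t => ∫ x, f x ∂κ t) s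

variable {T : ℝ} {φ : ℝ → Torus n → ℝ} {μ : Measure (ℝ × Torus n)}
  {ν : Measure ((ℝ × Torus n) × Vel n)} {κ : Kernel ℝ (Torus n)}

lemma WeaklyContinuousOn.continuousOn_integral [IsMarkovKernel κ] {S : Set ℝ} {K : NNReal}
    (hκ : WeaklyContinuousOn κ S) (hφ : LipschitzOnWith K (lift φ) (S ×ˢ univ)) :
    ContinuousOn (fun t => ∫ x, φ t x ∂κ t) S := by
  intro s hs
  have hint : ∀ r ∈ S, ∀ t, Integrable (φ r) (κ t) := fun r hr t =>
    (continuous_space hφ hr).integrable_of_hasCompactSupport (.of_compactSpace _)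
  have hfrozen := hκ ⟨φ s, continuous_space hφ hs⟩ s hs
  have hdiff : ∀ t ∈ S, ‖∫ x, φ t x ∂κ t - ∫ x, φ s x ∂κ t‖ ≤ K * dist t s := fun t ht => by
    rw [← integral_sub (hint t ht t) (hint s hs t)]
    refine (norm_integral_le_of_norm_le_const (C := K * dist t s)
      (Eventually.of_forall fun x => ?_)).trans_eq (by rw [probReal_univ, mul_one])
    exact (lipschitzOnWith_time hφ x).dist_le_mul t ht s hs
  have hdist : Tendsto (fun t => K * dist t s) (𝓝[S] s) (𝓝 0) := by
    have hcont : Continuous fun t => K * dist t s := by fun_prop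
    simpa using (hcont.tendsto s).mono_left nhdsWithin_le_nhds
  have hzero := squeeze_zero_norm' (eventually_mem_nhdsWithin.mono hdiff) hdist
  simpa only [ContinuousWithinAt, ContinuousMap.coe_mk, sub_add_cancel, zero_add] using
    hzero.add hfrozen

lemma integral_materialDeriv_eq_sub (hT : 0 < T) (hκ : Decomposes T μ κ)
    (hcont : WeaklyContinuousOn κ (Icc 0 T)) (hν : IsLifting T μ ν) (hE : kineticEnergy ν ≠ ∞)
    (hφ : φ ∈ C1Lip n T) :
    ∫ q, materialDeriv φ q ∂ν = ∫ x, φ T x ∂κ T - ∫ x, φ 0 x ∂κ 0 := by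
  have hmarkov := hκ.1
  obtain ⟨K, hK⟩ := hφ.2
  obtain ⟨c, hc⟩ := exists_ae_integral_eq_materialPrimitive_add hT hκ hν hE hφ
  rw [← ae_restrict_iff' measurableSet_Ioo, restrict_Ioo_eq_restrict_Icc] at hc
  have heq := Measure.eqOn_Icc_of_ae_eq volume hT.ne hc (hcont.continuousOn_integral hK)
    ((continuous_materialPrimitive hκ hν hE hφ).add_const c).continuousOn
  have hIoo := hν.measurePreserving.quasiMeasurePreserving.ae (ae_mem_Ioo_of_mem_Orbits ⟨κ, hκ⟩)
  have h0 : ∫ x, φ 0 x ∂κ 0 = materialPrimitive ν φ 0 + c := heq (left_mem_Icc.2 hT.le)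
  have h1 : ∫ x, φ T x ∂κ T = materialPrimitive ν φ T + c := heq (right_mem_Icc.2 hT.le)
  rw [h0, h1, materialPrimitive_zero hIoo, materialPrimitive_final hIoo]
  ring

end WeakContinuity

section Fourier

lemma contDiff_mFourier_proj (k : Fin n → ℤ) :
    ContDiff ℝ 1 fun y : Vel n => UnitAddTorus.mFourier k (proj y) := by
  simp only [UnitAddTorus.mFourier, ContinuousMap.coe_mk, proj, fourier_coe_apply]
  refine contDiff_prod fun i _ => ?_
  have hcoord : ContDiff ℝ 1 fun y : Vel n => ((y i : ℝ) : ℂ) :=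
    Complex.ofRealCLM.contDiff.comp (EuclideanSpace.proj (𝕜 := ℝ) i).contDiff
  exact ((contDiff_const.mul hcoord).div_const _).cexp

lemma exists_clm_eq_integral {X : Type*} (𝕜 : Type*) [RCLike 𝕜] [TopologicalSpace X]
    [CompactSpace X] [MeasurableSpace X] [BorelSpace X] (m : Measure X) [IsFiniteMeasure m] :
    ∃ L : C(X, 𝕜) →L[𝕜] 𝕜, ∀ f : C(X, 𝕜), L f = ∫ x, f x ∂m := by
  refine ⟨(L1.integralCLM' 𝕜).comp (ContinuousMap.toLp 1 m 𝕜), fun f => ?_⟩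
  rw [ContinuousLinearMap.comp_apply, ← L1.integral_eq', L1.integral_eq_integral]
  exact integral_congr_ae (ContinuousMap.coeFn_toLp m f)

lemma ext_of_integral_mFourier_eq {m m' : Measure (Torus n)} [IsFiniteMeasure m]
    [IsFiniteMeasure m']
    (h : ∀ k, ∫ x, UnitAddTorus.mFourier k x ∂m = ∫ x, UnitAddTorus.mFourier k x ∂m') :
    m = m' := by
  obtain ⟨L, hL⟩ := exists_clm_eq_integral ℂ m
  obtain ⟨L', hL'⟩ := exists_clm_eq_integral ℂ m'
  have hspan : Dense (Submodule.span ℂ (range (UnitAddTorus.mFourier (d := Fin n))) :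
      Set C(Torus n, ℂ)) := by
    rw [Submodule.dense_iff_topologicalClosure_eq_top]
    exact UnitAddTorus.span_mFourier_closure_eq_top
  have hLL' : L = L' := ContinuousLinearMap.ext_on hspan <| by
    rintro _ ⟨k, rfl⟩
    rw [hL, hL', h k]
  refine ext_of_forall_integral_eq_of_IsFiniteMeasure fun f => ?_
  have hcomplex : ∫ x, (f x : ℂ) ∂m = ∫ x, (f x : ℂ) ∂m' := by
    have hf := DFunLike.congr_fun hLL' ⟨fun x => (f x : ℂ), by fun_prop⟩
    rwa [hL, hL'] at hf
  exact_mod_cast hcomplex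

end Fourier

section ContinuousVersion

lemma exists_continuous_ae_eq {X Y : Type*} [TopologicalSpace X] [TopologicalSpace Y] {F : X → Y}
    (hF : IsClosedEmbedding F) {g : ℝ → Y} (hg : Continuous g) {a b : ℝ} (hab : a < b) {P : ℝ → X}
    (h : ∀ᵐ t, t ∈ Ioo a b → F (P t) = g t) :
    ∃ m : ℝ → X, Continuous m ∧ ∀ᵐ t, t ∈ Ioo a b → P t = m t := by
  have hrange : ∀ t ∈ Icc a b, g t ∈ range F := by
    have hdense := Measure.dense_of_ae h
    rw [← closure_Ioo hab.ne]
    refine fun t ht => closure_minimal ?_ (hF.isClosed_range.preimage hg)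
      (closure_minimal (hdense.open_subset_closure_inter isOpen_Ioo) isClosed_closure ht)
    exact fun s hs => ⟨P s, hs.2 hs.1⟩
  choose m hm using fun t : Icc a b => hrange t t.2
  refine ⟨fun t => m (projIcc a b hab.le t), ?_, h.mono fun t ht hmem => hF.injective ?_⟩
  · rw [hF.isEmbedding.continuous_iff]
    simp only [Function.comp_def, hm]
    exact hg.comp (continuous_subtype_val.comp continuous_projIcc)
  · rw [ht hmem, hm, projIcc_of_mem hab.le (Ioo_subset_Icc_self hmem)]

lemma isClosedEmbedding_integral_mFourier :
    IsClosedEmbedding fun (m : ProbabilityMeasure (Torus n)) (k : Fin n → ℤ) =>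
      ∫ x, UnitAddTorus.mFourier k x ∂(m : Measure (Torus n)) := by
  refine Continuous.isClosedEmbedding (continuous_pi fun k => ?_) fun ⟨m, _⟩ ⟨m', _⟩ h => ?_
  · refine continuous_iff_continuousAt.2 fun m => ?_
    exact (ProbabilityMeasure.tendsto_iff_forall_integral_rclike_tendsto ℂ).1 tendsto_id
      (BoundedContinuousFunction.mkOfCompact (UnitAddTorus.mFourier k))
  · exact Subtype.ext (ext_of_integral_mFourier_eq (congrFun h))

lemma measurable_coe_of_continuous {X Y : Type*} [TopologicalSpace X] [MeasurableSpace X]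
    [OpensMeasurableSpace X] [TopologicalSpace Y] [MeasurableSpace Y] [BorelSpace Y]
    [HasOuterApproxClosed Y] {m : X → ProbabilityMeasure Y} (hm : Continuous m) :
    Measurable fun t => (m t : Measure Y) := by
  refine Measurable.measure_of_isPiSystem_of_isProbabilityMeasure (S := {s | IsClosed s})
    (by rw [BorelSpace.measurable_eq (α := Y), borel_eq_generateFrom_isClosed]) isPiSystem_isClosed
    fun s (hs : IsClosed s) => ?_
  refine measurable_of_tendsto_metrizable (f := fun N t => ∫⁻ x, hs.apprSeq N x ∂(m t))
    (fun N => ?_) (tendsto_pi_nhds.2 fun t => HasOuterApproxClosed.tendsto_lintegral_apprSeq hs _)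
  exact (ProbabilityMeasure.continuous_iff_forall_continuous_lintegral.1 hm _).measurable

lemma mem_C1Lip_of_contDiff {T : ℝ} {φ : ℝ → Torus n → ℝ} (hT : 0 < T)
    (hφ : ContDiff ℝ 1 (lift φ)) : φ ∈ C1Lip n T :=
  ⟨hφ.contDiffOn, exists_lipschitzOnWith_lift isCompact_Icc (convex_Icc 0 T)
    (uniqueDiffOn_Icc hT) hφ.contDiffOn⟩

variable {T : ℝ} {μ : Measure (ℝ × Torus n)} {ν : Measure ((ℝ × Torus n) × Vel n)}
  {κ : Kernel ℝ (Torus n)}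

lemma exists_continuous_ae_eq_integral_mFourier (hT : 0 < T) (hκ : Decomposes T μ κ)
    (hν : IsLifting T μ ν) (hE : kineticEnergy ν ≠ ∞) (k : Fin n → ℤ) :
    ∃ g : ℝ → ℂ, Continuous g ∧
      ∀ᵐ t, t ∈ Ioo 0 T → ∫ x, UnitAddTorus.mFourier k x ∂κ t = g t := by
  have hmarkov := hκ.1
  have hreal : ∀ ℓ : ℂ →L[ℝ] ℝ, ∃ g : ℝ → ℝ, Continuous g ∧
      ∀ᵐ t, t ∈ Ioo 0 T → ∫ x, ℓ (UnitAddTorus.mFourier k x) ∂κ t = g t := fun ℓ => by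
    have hℓ : (fun _ x => ℓ (UnitAddTorus.mFourier k x)) ∈ C1Lip n T := mem_C1Lip_of_contDiff hT
      (ℓ.contDiff.comp ((contDiff_mFourier_proj k).comp contDiff_snd))
    obtain ⟨c, hc⟩ := exists_ae_integral_eq_materialPrimitive_add hT hκ hν hE hℓ
    exact ⟨_, (continuous_materialPrimitive hκ hν hE hℓ).add_const c, hc⟩
  obtain ⟨gre, hgre, hre⟩ := hreal Complex.reCLM
  obtain ⟨gim, hgim, him⟩ := hreal Complex.imCLM
  refine ⟨fun t => gre t + gim t * Complex.I, by fun_prop, ?_⟩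
  filter_upwards [hre, him] with t htre htim ht
  have hint : Integrable (UnitAddTorus.mFourier k) (κ t) :=
    (UnitAddTorus.mFourier k).continuous.integrable_of_hasCompactSupport (.of_compactSpace _)
  rw [← htre ht, ← htim ht]
  exact (integral_re_add_im hint).symm

lemma exists_weaklyContinuous_version (hT : 0 < T) (hμ : μ ∈ Orbits n T) (hν : IsLifting T μ ν)
    (hE : kineticEnergy ν ≠ ∞) :
    ∃ κ : Kernel ℝ (Torus n), Decomposes T μ κ ∧ WeaklyContinuousOn κ (Icc 0 T) := by
  obtain ⟨κ, hκ⟩ := hμ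
  have hmarkov := hκ.1
  choose g hg hκg using exists_continuous_ae_eq_integral_mFourier hT hκ hν hE
  obtain ⟨m, hm, hκm⟩ := exists_continuous_ae_eq (P := fun t => ⟨κ t, inferInstance⟩)
    isClosedEmbedding_integral_mFourier (continuous_pi hg) hT <| by
      filter_upwards [ae_all_iff.2 hκg] with t ht hmem using funext fun k => ht k hmem
  let κ' : Kernel ℝ (Torus n) := ⟨fun t => m t, measurable_coe_of_continuous hm⟩
  have hmarkov' : IsMarkovKernel κ' := ⟨fun t => (m t).2⟩
  refine ⟨κ', ⟨hmarkov', ?_⟩, fun f => ?_⟩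
  · rw [hκ.2, ← restrict_Ioo_eq_restrict_Icc]
    refine Measure.compProd_congr ?_
    filter_upwards [(ae_restrict_iff' measurableSet_Ioo).2 hκm] with t ht
      using congrArg Subtype.val ht
  · exact (ProbabilityMeasure.continuous_iff_forall_continuous_integral.1 hm
      (BoundedContinuousFunction.mkOfCompact f)).continuousOn

end ContinuousVersion

section Boundary

variable {T : ℝ} {μ : Measure (ℝ × Torus n)} {ν : Measure ((ℝ × Torus n) × Vel n)}
  {κ : Kernel ℝ (Torus n)} {μ₀ μ₁ : Measure (Torus n)} {φ : ℝ → Torus n → ℝ}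

lemma hjBoundary_of_mem_C10 (hφ : φ ∈ C10 n T) : hjBoundary T μ μ₀ μ₁ φ = hjIntegral μ φ := by
  simp only [hjBoundary, hφ.2.1, hφ.2.2, integral_zero, add_zero, sub_zero]

lemma iInf_hjBoundary_le_iInf_hjIntegral (hT : 0 < T) :
    ⨅ φ ∈ C1Lip n T, ((hjBoundary T μ μ₀ μ₁ φ : ℝ) : EReal) ≤
      ⨅ φ ∈ C10 n T, ((hjIntegral μ φ : ℝ) : EReal) :=
  le_iInf₂ fun φ hφ => (iInf₂_le φ (C10_subset_C1Lip hT hφ)).trans_eq <| by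
    rw [hjBoundary_of_mem_C10 hφ]

lemma tendsto_youngDefect_mul {η : ℕ → ℝ → ℝ} (hη : ∀ N, Continuous (η N))
    (hbound : ∀ᵐ q ∂ν, ∀ N, |η N q.1.1| ≤ 1)
    (hlim : ∀ᵐ q ∂ν, Tendsto (fun N => η N q.1.1) atTop (𝓝 0))
    (hgrad : Integrable (fun q => ‖spaceGrad φ q.1.1 q.1.2‖ ^ 2) ν)
    (hinner : Integrable (fun q => inner ℝ q.2 (spaceGrad φ q.1.1 q.1.2)) ν) :
    Tendsto (fun N => youngDefect ν fun t x => η N t * φ t x) atTop (𝓝 0) := by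
  have hdefect : ∀ N, youngDefect ν (fun t x => η N t * φ t x) =
      ∫ q, (η N q.1.1 ^ 2 * (‖spaceGrad φ q.1.1 q.1.2‖ ^ 2 / 2) -
        η N q.1.1 * inner ℝ q.2 (spaceGrad φ q.1.1 q.1.2)) ∂ν := fun N => by
    simp only [youngDefect, spaceGrad_mul, norm_smul, mul_pow, Real.norm_eq_abs, sq_abs,
      real_inner_smul_right, mul_div_assoc]
  have hmeas : ∀ N, AEStronglyMeasurable (fun q : (ℝ × Torus n) × Vel n => η N q.1.1) ν := fun N =>
    ((hη N).comp (continuous_fst.comp continuous_fst)).aestronglyMeasurable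
  simp only [hdefect]
  rw [← integral_zero ((ℝ × Torus n) × Vel n) ℝ (μ := ν)]
  refine tendsto_integral_of_dominated_convergence
    (fun q => ‖spaceGrad φ q.1.1 q.1.2‖ ^ 2 / 2 + ‖inner ℝ q.2 (spaceGrad φ q.1.1 q.1.2)‖)
    (fun N => (((hmeas N).pow 2).mul (hgrad.div_const 2).aestronglyMeasurable).sub
      ((hmeas N).mul hinner.aestronglyMeasurable)) ((hgrad.div_const 2).add hinner.norm)
    (fun N => ?_) ?_
  · filter_upwards [hbound] with q hq
    refine (norm_sub_le _ _).trans (add_le_add ?_ ?_)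
    · rw [Real.norm_of_nonneg (by positivity)]
      exact mul_le_of_le_one_left (by positivity) ((sq_le_one_iff_abs_le_one _).2 (hq N))
    · rw [norm_mul]
      exact mul_le_of_le_one_left (norm_nonneg _) (hq N)
  · filter_upwards [hlim] with q hq
    simpa using ((hq.pow 2).mul_const (‖spaceGrad φ q.1.1 q.1.2‖ ^ 2 / 2)).sub
      (hq.mul_const (inner ℝ q.2 (spaceGrad φ q.1.1 q.1.2)))

lemma exists_contDiff_integral_ne {m m' : Measure (Torus n)} [IsFiniteMeasure m]
    [IsFiniteMeasure m'] (hne : m ≠ m') :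
    ∃ f : Torus n → ℝ, ContDiff ℝ 1 (fun y : Vel n => f (proj y)) ∧
      ∫ x, f x ∂m ≠ ∫ x, f x ∂m' := by
  by_contra! heq
  refine hne (ext_of_integral_mFourier_eq fun k => ?_)
  have hint : ∀ (ρ : Measure (Torus n)) [IsFiniteMeasure ρ],
      Integrable (UnitAddTorus.mFourier k) ρ := fun ρ _ =>
    (UnitAddTorus.mFourier k).continuous.integrable_of_hasCompactSupport (.of_compactSpace _)
  have hpart : ∀ ℓ : ℂ →L[ℝ] ℝ, ∫ x, ℓ (UnitAddTorus.mFourier k x) ∂m =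
      ∫ x, ℓ (UnitAddTorus.mFourier k x) ∂m' := fun ℓ =>
    heq (fun x => ℓ (UnitAddTorus.mFourier k x)) (ℓ.contDiff.comp (contDiff_mFourier_proj k))
  rw [← integral_re_add_im (hint m), ← integral_re_add_im (hint m')]
  exact congrArg₂ (fun r s : ℝ => (r + s * Complex.I : ℂ)) (hpart Complex.reCLM)
    (hpart Complex.imCLM)

section WeaklyContinuous

variable (hT : 0 < T) (hκ : Decomposes T μ κ) (hcont : WeaklyContinuousOn κ (Icc 0 T))
  (hν : IsLifting T μ ν) (hE : kineticEnergy ν ≠ ∞)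
include hT hκ hcont hν hE

lemma hjBoundary_eq_youngDefect_add (hφ : φ ∈ C1Lip n T) :
    hjBoundary T μ μ₀ μ₁ φ = youngDefect ν φ +
      ((∫ x, φ 0 x ∂μ₀ - ∫ x, φ 0 x ∂κ 0) + (∫ x, φ T x ∂κ T - ∫ x, φ T x ∂μ₁)) := by
  have hμ : μ ∈ Orbits n T := ⟨κ, hκ⟩
  have := isFiniteMeasure_of_mem_Orbits hμ
  rw [hjBoundary, hjIntegral_eq_integral_materialDeriv_add_youngDefect
    (ae_mem_Ioo_of_mem_Orbits hμ) hν.measurePreserving hE hφ,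
    integral_materialDeriv_eq_sub hT hκ hcont hν hE hφ]
  ring

lemma tendsto_hjBoundary_pow_mul {e : ℝ → ℝ} (he : ContDiff ℝ 1 e)
    (hmaps : MapsTo e (Ioo 0 T) (Ico 0 1)) (h0 : IsIdempotentElem (e 0))
    (h1 : IsIdempotentElem (e T)) {f : Torus n → ℝ}
    (hf : ContDiff ℝ 1 fun y : Vel n => f (proj y)) :
    Tendsto (fun N => hjBoundary T μ μ₀ μ₁ fun t x => e t ^ (N + 1) * f x) atTop
      (𝓝 (e 0 * (∫ x, f x ∂μ₀ - ∫ x, f x ∂κ 0) + e T * (∫ x, f x ∂κ T - ∫ x, f x ∂μ₁))) := by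
  have hμ : μ ∈ Orbits n T := ⟨κ, hκ⟩
  have := isFiniteMeasure_of_mem_Orbits hμ
  have hIoo := ae_mem_Ioo_of_mem_Orbits hμ
  have hfst := hν.measurePreserving
  have hIooν := hfst.quasiMeasurePreserving.ae hIoo
  have hF : (fun _ => f) ∈ C1Lip n T := mem_C1Lip_of_contDiff hT (hf.comp contDiff_snd)
  have hpowF : ∀ N, (fun t x => e t ^ (N + 1) * f x) ∈ C1Lip n T := fun N =>
    mem_C1Lip_of_contDiff hT (((he.comp contDiff_fst).pow _).mul (hf.comp contDiff_snd))
  have hdefect : Tendsto (fun N => youngDefect ν fun t x => e t ^ (N + 1) * f x) atTop (𝓝 0) := by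
    refine tendsto_youngDefect_mul (φ := fun _ => f) (fun N => he.continuous.pow _)
      (hIooν.mono fun q hq N => ?_) (hIooν.mono fun q hq => ?_)
      (hfst.integrable_comp_of_integrable (integrable_norm_sq_spaceGrad hIoo hF))
      (integrable_inner_spaceGrad hIoo hfst hE hF)
    · rw [abs_pow, abs_of_nonneg (hmaps hq).1]
      exact pow_le_one₀ (hmaps hq).1 (hmaps hq).2.le
    · exact (tendsto_pow_atTop_nhds_zero_of_lt_one (hmaps hq).1 (hmaps hq).2).comp
        (tendsto_add_atTop_nat 1)
  simp only [hjBoundary_eq_youngDefect_add hT hκ hcont hν hE (hpowF _), h0.pow_succ_eq,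
    h1.pow_succ_eq, integral_const_mul, ← mul_sub]
  simpa only [zero_add] using hdefect.add_const _

lemma iInf_hjBoundary_eq_bot {e : ℝ → ℝ} (he : ContDiff ℝ 1 e)
    (hmaps : MapsTo e (Ioo 0 T) (Ico 0 1)) (h0 : IsIdempotentElem (e 0))
    (h1 : IsIdempotentElem (e T)) {f : Torus n → ℝ}
    (hf : ContDiff ℝ 1 fun y : Vel n => f (proj y))
    (hne : e 0 * (∫ x, f x ∂μ₀ - ∫ x, f x ∂κ 0) + e T * (∫ x, f x ∂κ T - ∫ x, f x ∂μ₁) ≠ 0) :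
    ⨅ φ ∈ C1Lip n T, ((hjBoundary T μ μ₀ μ₁ φ : ℝ) : EReal) = ⊥ := by
  set d := e 0 * (∫ x, f x ∂μ₀ - ∫ x, f x ∂κ 0) + e T * (∫ x, f x ∂κ T - ∫ x, f x ∂μ₁)
  have hle : ∀ c : ℝ, ⨅ φ ∈ C1Lip n T, ((hjBoundary T μ μ₀ μ₁ φ : ℝ) : EReal) ≤
      ((c * d : ℝ) : EReal) := fun c => by
    have hcf : ContDiff ℝ 1 fun y : Vel n => c * f (proj y) := contDiff_const.mul hf
    have hlim := tendsto_hjBoundary_pow_mul (μ₀ := μ₀) (μ₁ := μ₁) hT hκ hcont hν hE he hmaps h0 h1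
      (f := fun x => c * f x) hcf
    have hcd : e 0 * (∫ x, c * f x ∂μ₀ - ∫ x, c * f x ∂κ 0) +
        e T * (∫ x, c * f x ∂κ T - ∫ x, c * f x ∂μ₁) = c * d := by
      simp only [integral_const_mul, d]
      ring
    rw [hcd] at hlim
    refine ge_of_tendsto' ((continuous_coe_real_ereal.tendsto _).comp hlim) fun N => ?_
    exact iInf₂_le _ <| mem_C1Lip_of_contDiff hT <|
      ((he.comp contDiff_fst).pow _).mul (hcf.comp contDiff_snd)
  refine (EReal.eq_bot_iff_forall_lt _).2 fun y => (hle ((y - 1) / d)).trans_lt ?_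
  rw [div_mul_cancel₀ _ hne]
  exact EReal.coe_lt_coe_iff.2 (sub_one_lt y)

lemma iInf_hjBoundary_eq_bot_of_initial_ne [IsFiniteMeasure μ₀] (hne : κ 0 ≠ μ₀) :
    ⨅ φ ∈ C1Lip n T, ((hjBoundary T μ μ₀ μ₁ φ : ℝ) : EReal) = ⊥ := by
  have hmarkov := hκ.1
  obtain ⟨f, hf, hint⟩ := exists_contDiff_integral_ne hne
  refine iInf_hjBoundary_eq_bot hT hκ hcont hν hE (e := fun t => 1 - t / T)
    (contDiff_const.sub (contDiff_id.div_const T)) (fun t ht => ?_)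
    (by simp [IsIdempotentElem]) (by simp [IsIdempotentElem, hT.ne']) hf ?_
  · exact ⟨sub_nonneg.2 ((div_lt_one hT).2 ht.2).le, sub_lt_self 1 (div_pos ht.1 hT)⟩
  · simpa [hT.ne', sub_eq_zero] using hint.symm

lemma iInf_hjBoundary_eq_bot_of_final_ne [IsFiniteMeasure μ₁] (hne : κ T ≠ μ₁) :
    ⨅ φ ∈ C1Lip n T, ((hjBoundary T μ μ₀ μ₁ φ : ℝ) : EReal) = ⊥ := by
  have hmarkov := hκ.1
  obtain ⟨f, hf, hint⟩ := exists_contDiff_integral_ne hne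
  refine iInf_hjBoundary_eq_bot hT hκ hcont hν hE (e := fun t => t / T)
    (contDiff_id.div_const T) (fun t ht => ⟨(div_pos ht.1 hT).le, (div_lt_one hT).2 ht.2⟩)
    (by simp [IsIdempotentElem]) (by simp [IsIdempotentElem, hT.ne']) hf ?_
  simpa [hT.ne', sub_eq_zero] using hint

end WeaklyContinuous

lemma neg_iInf_hjBoundary_of_mem_Lam (hT : 0 < T) (hL : μ ∈ Lam T 2 μ₀ μ₁) :
    -(⨅ φ ∈ C1Lip n T, ((hjBoundary T μ μ₀ μ₁ φ : ℝ) : EReal)) =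
      (((1 / 2 : ℝ≥0∞) * hNorm T 2 μ ^ 2 : ℝ≥0∞) : EReal) := by
  obtain ⟨⟨hμ, -⟩, κ, hκ, hcont, rfl, rfl⟩ := hL
  have := isFiniteMeasure_of_mem_Orbits hμ
  have hIoo := ae_mem_Ioo_of_mem_Orbits hμ
  refine le_antisymm (neg_iInf_le_iff.2 fun φ hφ => coe_le_half_hNorm_sq fun ν hν hE => ?_) ?_
  · rw [hjBoundary_eq_youngDefect_add hT hκ hcont hν hE hφ, sub_self, sub_self, add_zero, add_zero]
    exact neg_youngDefect_le hIoo hν.measurePreserving hE hφ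
  · rw [half_hNorm_sq_eq_neg_iInf_hjIntegral hT hIoo, EReal.neg_le_neg_iff]
    exact iInf_hjBoundary_le_iInf_hjIntegral hT

lemma iInf_hjBoundary_of_notMem_Lam (hT : 0 < T) (hμ : μ ∈ Orbits n T) [IsFiniteMeasure μ₀]
    [IsFiniteMeasure μ₁] (hL : μ ∉ Lam T 2 μ₀ μ₁) :
    ⨅ φ ∈ C1Lip n T, ((hjBoundary T μ μ₀ μ₁ φ : ℝ) : EReal) = ⊥ := by
  by_cases hH : ∃ ν, IsLifting T μ ν ∧ kineticEnergy ν < ∞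
  · obtain ⟨ν, hν, hE⟩ := hH
    obtain ⟨κ, hκ, hcont⟩ := exists_weaklyContinuous_version hT hμ hν hE.ne
    by_cases h0 : κ 0 = μ₀
    · have h1 : κ T ≠ μ₁ := fun h1 => hL ⟨⟨hμ, ν, hν, hE⟩, κ, hκ, hcont, h0, h1⟩
      exact iInf_hjBoundary_eq_bot_of_final_ne hT hκ hcont hν hE.ne h1
    · exact iInf_hjBoundary_eq_bot_of_initial_ne hT hκ hcont hν hE.ne h0
  · have := isFiniteMeasure_of_mem_Orbits hμ
    have htop : hNorm T 2 μ ^ 2 = ∞ := by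
      rw [hNorm_two_sq]
      exact iInf₂_eq_top.2 fun ν hν => not_lt_top_iff.1 fun hE => hH ⟨ν, hν, hE⟩
    have hdual := half_hNorm_sq_eq_neg_iInf_hjIntegral hT (ae_mem_Ioo_of_mem_Orbits hμ)
    rw [htop, ENNReal.mul_top (by simp), EReal.coe_ennreal_top, eq_comm, EReal.neg_eq_top_iff]
      at hdual
    exact le_bot_iff.1 ((iInf_hjBoundary_le_iInf_hjIntegral hT).trans_eq hdual)

end Boundary

end MeasureOrbit

theorem corollary4p1_general (n : ℕ) (T : ℝ) (hT : 0 < T)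
    (μ : Measure (ℝ × MeasureOrbit.Torus n)) (hμ : μ ∈ MeasureOrbit.Orbits n T) :
    ((((1 / 2 : ℝ≥0∞) * MeasureOrbit.hNorm T 2 μ ^ 2 : ℝ≥0∞) : EReal) =
        -⨅ φ ∈ MeasureOrbit.C10 n T, ((MeasureOrbit.hjIntegral μ φ : ℝ) : EReal)) ∧
    ((1 / 2 : ℝ≥0∞) * MeasureOrbit.hNorm T 2 μ ^ 2 =
        (1 / 2 : ℝ≥0∞) * ⨆ φ ∈ MeasureOrbit.C10 n T, MeasureOrbit.quotient μ φ) ∧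
    ∀ (μ₀ μ₁ : Measure (MeasureOrbit.Torus n)) [IsFiniteMeasure μ₀] [IsFiniteMeasure μ₁],
      (μ ∈ MeasureOrbit.Lam T 2 μ₀ μ₁ →
        -(⨅ φ ∈ MeasureOrbit.C1Lip n T, ((MeasureOrbit.hjBoundary T μ μ₀ μ₁ φ : ℝ) : EReal)) =
          (((1 / 2 : ℝ≥0∞) * MeasureOrbit.hNorm T 2 μ ^ 2 : ℝ≥0∞) : EReal)) ∧
      (μ ∉ MeasureOrbit.Lam T 2 μ₀ μ₁ →
        -(⨅ φ ∈ MeasureOrbit.C1Lip n T, ((MeasureOrbit.hjBoundary T μ μ₀ μ₁ φ : ℝ) : EReal)) =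
          ⊤) := by
  have := MeasureOrbit.isFiniteMeasure_of_mem_Orbits hμ
  have hIoo := MeasureOrbit.ae_mem_Ioo_of_mem_Orbits hμ
  refine ⟨MeasureOrbit.half_hNorm_sq_eq_neg_iInf_hjIntegral hT hIoo,
    by rw [MeasureOrbit.hNorm_sq_eq_iSup_quotient hT hIoo], fun μ₀ μ₁ _ _ =>
    ⟨MeasureOrbit.neg_iInf_hjBoundary_of_mem_Lam hT, fun hL => ?_⟩⟩
  rw [MeasureOrbit.iInf_hjBoundary_of_notMem_Lam hT hμ hL, EReal.neg_bot]

theorem corollary4p1 (n : ℕ) (T : ℝ) (hT : 0 < T)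
    (μ : Measure (ℝ × MeasureOrbit.Torus n)) (hμ : μ ∈ MeasureOrbit.H n T 2) :
    ((((1 / 2 : ℝ≥0∞) * MeasureOrbit.hNorm T 2 μ ^ 2 : ℝ≥0∞) : EReal) =
        -⨅ φ ∈ MeasureOrbit.C10 n T, ((MeasureOrbit.hjIntegral μ φ : ℝ) : EReal)) ∧
    ((1 / 2 : ℝ≥0∞) * MeasureOrbit.hNorm T 2 μ ^ 2 =
        (1 / 2 : ℝ≥0∞) * ⨆ φ ∈ MeasureOrbit.C10 n T, MeasureOrbit.quotient μ φ) ∧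
    ∀ (μ₀ μ₁ : Measure (MeasureOrbit.Torus n)) [IsProbabilityMeasure μ₀] [IsProbabilityMeasure μ₁],
      (μ ∈ MeasureOrbit.Lam T 2 μ₀ μ₁ →
        -(⨅ φ ∈ MeasureOrbit.C1Lip n T, ((MeasureOrbit.hjBoundary T μ μ₀ μ₁ φ : ℝ) : EReal)) =
          (((1 / 2 : ℝ≥0∞) * MeasureOrbit.hNorm T 2 μ ^ 2 : ℝ≥0∞) : EReal)) ∧
      (μ ∉ MeasureOrbit.Lam T 2 μ₀ μ₁ →
        -(⨅ φ ∈ MeasureOrbit.C1Lip n T, ((MeasureOrbit.hjBoundary T μ μ₀ μ₁ φ : ℝ) : EReal)) =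
          ⊤) :=
  have h := corollary4p1_general n T hT μ hμ.1
  ⟨h.1, h.2.1, fun μ₀ μ₁ _ _ => h.2.2 μ₀ μ₁⟩
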